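/- **Theorem (Uniqueness).** Let $\Omega\subset\mathbb R^d$, $d\ge 2$, be a bounded domain (non-empty, open, connected) with smooth boundary $\Gamma=\partial\Omega$ carrying its $(d-1)$-dimensional measure, and let $T>0$, $\nu>0$. Set $H=L^2(\Omega)$, $V=H^1(\Omega)$, $H_\Gamma=L^2(\Gamma)$, $V_\Gamma=H^1(\Gamma)$ and $\mathcal V=\{z\in V: z|_\Gamma\in V_\Gamma\}$, where $z|_\Gamma$ is the trace; $\nabla_\Gamma$ is the surface gradient, and $V\subset H\cong H^*\subset V^*$, $V_\Gamma\subset H_\Gamma\cong H_\Gamma^*\subset V_\Gamma^*$. Let $\hat\beta,\hat\beta_\Gamma:\mathbb R\to[0,+\infty]$ be convex, proper and lower semicontinuous with $\hat\beta(0)=\hat\beta_\Gamma(0)=0$, with subdifferentials $\beta=\partial\hat\beta$ and $\beta_\Gamma=\partial\hat\beta_\Gamma$, and let $\pi,\pi_\Gamma:\mathbb R\to\mathbb R$ be Lipschitz continuous. Let $f\in L^2(0,T;H)$, $f_\Gamma\in L^2(0,T;H_\Gamma)$, $u_0\in H$ and $v_0\in H_\Gamma$. A *solution* with these data is a quadruple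 $(u,v,\xi,\xi_\Gamma)$ such that $$u\in L^2(0,T;V)\cap H^1(0,T;V^*),\qquad v=u|_\Gamma\in L^2(0,T;V_\Gamma)\cap H^1(0,T;V_\Gamma^*),$$ $$\xi\in L^2(0,T;H),\quad \xi\in\beta(u)\ \text{a.e. in }\Omega\times(0,T),\qquad \xi_\Gamma\in L^2(0,T;H_\Gamma),\quad \xi_\Gamma\in\beta_\Gamma(v)\ \text{a.e. on }\Gamma\times(0,T),$$ $u(0)=u_0$ in $H$ and $v(0)=v_0$ in $H_\Gamma$ (for the representatives of $u$ in $C^0([0,T];H)$ and of $v$ in $C^0([0,T];H_\Gamma)$), and, for almost every $t\in(0,T)$ and every $z\in\mathcal V$, $$\langle\partial_t u(t),z\rangle_{V^*,V}+\int_\Omega\nabla u(t)\cdot\nabla z+\int_\Omega(\xi(t)+\pi(u(t)))\,z+\langle\partial_t v(t),z|_\Gamma\rangle_{V_\Gamma^*,V_\Gamma}+\nu\int_\Gamma\nabla_\Gamma v(t)\cdot\nabla_\Gamma z|_\Gamma+\int_\Gamma(\xi_\Gamma(t)+\pi_\Gamma(v(t)))\,z|_\Gamma=\int_\Omega f(t)\,z+\int_\Gamma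 f_\Gamma(t)\,z|_\Gamma .$$ If $(u_1,v_1,\xi_1,\xi_{\Gamma,1})$ and $(u_2,v_2,\xi_2,\xi_{\Gamma,2})$ are two solutions with the same data, then they coincide: $u_1=u_2$, $v_1=v_2$, $\xi_1=\xi_2$ and $\xi_{\Gamma,1}=\xi_{\Gamma,2}$. -/

import Mathlib

open MeasureTheory Set Filter Topology
open scoped ENNReal NNReal ContDiff RealInnerProductSpace Gradient

noncomputable section

namespace AllenCahn

/-! ### Domains with smooth boundary, surface measure -/

/-- Euclidean space `ℝᵈ`. -/
abbrev Euc (d : ℕ) : Type := EuclideanSpace ℝ (Fin d)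

/-- `Ω` has a smooth boundary: near each boundary point, in suitable orthonormal coordinates,
`Ω` is the strict epigraph of a smooth function of the `d - 1` coordinates orthogonal to a unit
vector `e`. -/
def HasSmoothBoundary {d : ℕ} (Ω : Set (Euc d)) : Prop :=
  ∀ x ∈ frontier Ω, ∃ e : Euc d, ‖e‖ = 1 ∧ ∃ γ : Euc d → ℝ, ContDiff ℝ ∞ γ ∧ ∃ r > 0,
    ∀ y ∈ Metric.ball x r, (y ∈ Ω ↔ γ (y - ⟪e, y⟫ • e) < ⟪e, y⟫)

/-- Lebesgue measure on `Ω`. -/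
abbrev bulkMeasure {d : ℕ} (Ω : Set (Euc d)) : Measure (Euc d) := volume.restrict Ω

/-- The `(d-1)`-dimensional (normalized Hausdorff) measure on the boundary `Γ = ∂Ω`. -/
abbrev surfaceMeasure {d : ℕ} (Ω : Set (Euc d)) : Measure (Euc d) :=
  (Measure.euclideanHausdorffMeasure (d - 1) : Measure (Euc d)).restrict (frontier Ω)

/-- Lebesgue measure on the time interval `(0, T)`. -/
abbrev timeMeasure (T : ℝ) : Measure ℝ := volume.restrict (Ioo 0 T)

/-- `H = L²(Ω)`. -/
abbrev HBulk {d : ℕ} (Ω : Set (Euc d)) : Type := Lp ℝ 2 (bulkMeasure Ω)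

/-- `H_Γ = L²(Γ)`. -/
abbrev HBdry {d : ℕ} (Ω : Set (Euc d)) : Type := Lp ℝ 2 (surfaceMeasure Ω)

/-- `L²(0,T;X)`. -/
abbrev L2Time (T : ℝ) (X : Type) [NormedAddCommGroup X] : Type := Lp X 2 (timeMeasure T)

/-- Smooth, compactly supported functions on `ℝᵈ`. -/
def IsTest {d : ℕ} (φ : Euc d → ℝ) : Prop := ContDiff ℝ ∞ φ ∧ HasCompactSupport φ

/-! ### The space `V = H¹(Ω)` -/

/-- `G ∈ L²(Ω)ᵈ` is the weak gradient of `w ∈ L²(Ω)`. -/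
def IsWeakGradient {d : ℕ} (Ω : Set (Euc d)) (w : HBulk Ω)
    (G : Lp (Euc d) 2 (bulkMeasure Ω)) : Prop :=
  ∀ φ : Euc d → ℝ, IsTest φ → tsupport φ ⊆ Ω →
    ∫ x in Ω, w x • ∇ φ x = - ∫ x in Ω, φ x • G x

theorem IsTest.memLp {d : ℕ} {φ : Euc d → ℝ} (h : IsTest φ) (μ : Measure (Euc d))
    [IsFiniteMeasureOnCompacts μ] : MemLp φ 2 μ :=
  h.1.continuous.memLp_of_hasCompactSupport h.2

theorem IsTest.gradient_memLp {d : ℕ} {φ : Euc d → ℝ} (h : IsTest φ) (μ : Measure (Euc d))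
    [IsFiniteMeasureOnCompacts μ] : MemLp (∇ φ) 2 μ := by
  have hc : Continuous (∇ φ) :=
    (InnerProductSpace.toDual ℝ (Euc d)).symm.continuous.comp (h.1.continuous_fderiv (by simp))
  refine hc.memLp_of_hasCompactSupport ?_
  exact (h.2.fderiv (𝕜 := ℝ)).comp_left
    (g := (InnerProductSpace.toDual ℝ (Euc d)).symm) (map_zero _)

theorem IsTest.integrable_smul_gradient {d : ℕ} {Ω : Set (Euc d)} {φ : Euc d → ℝ}
    (h : IsTest φ) (w : HBulk Ω) : Integrable (fun x => w x • ∇ φ x) (bulkMeasure Ω) :=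
  memLp_one_iff_integrable.1 ((h.gradient_memLp _).smul (Lp.memLp w))

theorem IsTest.integrable_smul {d : ℕ} {Ω : Set (Euc d)} {φ : Euc d → ℝ}
    (h : IsTest φ) (G : Lp (Euc d) 2 (bulkMeasure Ω)) :
    Integrable (fun x => φ x • G x) (bulkMeasure Ω) :=
  memLp_one_iff_integrable.1 ((Lp.memLp G).smul (h.memLp _))

/-- `V = H¹(Ω)`: a function `w ∈ L²(Ω)` having a weak gradient `∇w ∈ L²(Ω)ᵈ`, recorded as the
pair `(w, ∇w)` (for open `Ω` the weak gradient is determined by `w`). The norm inherited from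
`L²(Ω) × L²(Ω)ᵈ` is the usual one, `‖w‖² + ‖∇w‖²`. -/
def VBulk {d : ℕ} (Ω : Set (Euc d)) :
    Submodule ℝ (WithLp 2 (HBulk Ω × Lp (Euc d) 2 (bulkMeasure Ω))) where
  carrier := {p | IsWeakGradient Ω p.fst p.snd}
  zero_mem' := by
    intro φ _ _
    have h1 : (fun x => (0 : HBulk Ω) x • ∇ φ x) =ᵐ[bulkMeasure Ω] fun _ => 0 := by
      filter_upwards [Lp.coeFn_zero ℝ 2 (bulkMeasure Ω)] with x hx
      rw [hx, Pi.zero_apply, zero_smul]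
    have h2 : (fun x => φ x • (0 : Lp (Euc d) 2 (bulkMeasure Ω)) x) =ᵐ[bulkMeasure Ω]
        fun _ => 0 := by
      filter_upwards [Lp.coeFn_zero (Euc d) 2 (bulkMeasure Ω)] with x hx
      rw [hx, Pi.zero_apply, smul_zero]
    change ∫ x in Ω, (0 : HBulk Ω) x • ∇ φ x
      = - ∫ x in Ω, φ x • (0 : Lp (Euc d) 2 (bulkMeasure Ω)) x
    rw [integral_congr_ae h1, integral_congr_ae h2]
    simp
  add_mem' := by
    intro p q hp hq φ hφ hs
    have h1 : (fun x => (p.fst + q.fst) x • ∇ φ x) =ᵐ[bulkMeasure Ω]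
        fun x => p.fst x • ∇ φ x + q.fst x • ∇ φ x := by
      filter_upwards [Lp.coeFn_add p.fst q.fst] with x hx
      rw [hx, Pi.add_apply, add_smul]
    have h2 : (fun x => φ x • (p.snd + q.snd) x) =ᵐ[bulkMeasure Ω]
        fun x => φ x • p.snd x + φ x • q.snd x := by
      filter_upwards [Lp.coeFn_add p.snd q.snd] with x hx
      rw [hx, Pi.add_apply, smul_add]
    change ∫ x in Ω, (p.fst + q.fst) x • ∇ φ x = - ∫ x in Ω, φ x • (p.snd + q.snd) x
    rw [integral_congr_ae h1, integral_congr_ae h2,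
      integral_add (hφ.integrable_smul_gradient _) (hφ.integrable_smul_gradient _),
      integral_add (hφ.integrable_smul _) (hφ.integrable_smul _), hp φ hφ hs, hq φ hφ hs, neg_add]
  smul_mem' := by
    intro c p hp φ hφ hs
    have h1 : (fun x => (c • p.fst) x • ∇ φ x) =ᵐ[bulkMeasure Ω]
        fun x => c • (p.fst x • ∇ φ x) := by
      filter_upwards [Lp.coeFn_smul c p.fst] with x hx
      simp [hx, mul_smul]
    have h2 : (fun x => φ x • (c • p.snd) x) =ᵐ[bulkMeasure Ω]
        fun x => c • (φ x • p.snd x) := by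
      filter_upwards [Lp.coeFn_smul c p.snd] with x hx
      simp [hx, smul_comm c]
    change ∫ x in Ω, (c • p.fst) x • ∇ φ x = - ∫ x in Ω, φ x • (c • p.snd) x
    rw [integral_congr_ae h1, integral_congr_ae h2, integral_smul, integral_smul, hp φ hφ hs,
      smul_neg]

/-- The inclusion `V → H`. -/
def VBulk.val {d : ℕ} {Ω : Set (Euc d)} : VBulk Ω →L[ℝ] HBulk Ω :=
  (WithLp.fstL 2 ℝ (HBulk Ω) (Lp (Euc d) 2 (bulkMeasure Ω))).comp (VBulk Ω).subtypeL

/-- The weak gradient `V → L²(Ω)ᵈ`. -/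
def VBulk.grad {d : ℕ} {Ω : Set (Euc d)} : VBulk Ω →L[ℝ] Lp (Euc d) 2 (bulkMeasure Ω) :=
  (WithLp.sndL 2 ℝ (HBulk Ω) (Lp (Euc d) 2 (bulkMeasure Ω))).comp (VBulk Ω).subtypeL

/-! ### The space `V_Γ = H¹(Γ)` -/

/-- The tangential gradient `∇_Γ φ(x)`: the orthogonal projection of `∇φ(x)` onto the tangent
space of `Γ = ∂Ω` at `x`. -/
def tangentialGradient {d : ℕ} (Ω : Set (Euc d)) (φ : Euc d → ℝ) (x : Euc d) : Euc d :=
  (Submodule.span ℝ (tangentConeAt ℝ (frontier Ω) x)).starProjection (∇ φ x)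

theorem IsTest.zero {d : ℕ} : IsTest (fun _ : Euc d => (0 : ℝ)) :=
  ⟨contDiff_const, HasCompactSupport.zero⟩

theorem IsTest.add {d : ℕ} {φ ψ : Euc d → ℝ} (hφ : IsTest φ) (hψ : IsTest ψ) :
    IsTest (fun x => φ x + ψ x) :=
  ⟨hφ.1.add hψ.1, hφ.2.add hψ.2⟩

theorem IsTest.const_mul {d : ℕ} {φ : Euc d → ℝ} (c : ℝ) (hφ : IsTest φ) :
    IsTest (fun x => c * φ x) :=
  ⟨contDiff_const.mul hφ.1, hφ.2.mul_left⟩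

theorem IsTest.gradient_add {d : ℕ} {φ ψ : Euc d → ℝ} (hφ : IsTest φ) (hψ : IsTest ψ)
    (x : Euc d) : ∇ (fun y => φ y + ψ y) x = ∇ φ x + ∇ ψ x := by
  have h1 : DifferentiableAt ℝ φ x := hφ.1.differentiable (by simp) x
  have h2 : DifferentiableAt ℝ ψ x := hψ.1.differentiable (by simp) x
  simp only [gradient]
  rw [fderiv_fun_add h1 h2, map_add]

theorem IsTest.gradient_const_mul {d : ℕ} {φ : Euc d → ℝ} (c : ℝ) (hφ : IsTest φ)
    (x : Euc d) : ∇ (fun y => c * φ y) x = c • ∇ φ x := by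
  have h1 : DifferentiableAt ℝ φ x := hφ.1.differentiable (by simp) x
  simp only [gradient]
  rw [fderiv_const_mul h1, map_smulₛₗ]
  simp

/-- The smooth functions on `Γ` with their tangential gradients, as pairs `(φ|_Γ, ∇_Γ φ)`
in `L²(Γ) × L²(Γ)ᵈ`. -/
def smoothBdry {d : ℕ} (Ω : Set (Euc d)) :
    Submodule ℝ (WithLp 2 (HBdry Ω × Lp (Euc d) 2 (surfaceMeasure Ω))) where
  carrier := {p | ∃ φ : Euc d → ℝ, IsTest φ ∧ p.fst =ᵐ[surfaceMeasure Ω] φ ∧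
    p.snd =ᵐ[surfaceMeasure Ω] tangentialGradient Ω φ}
  zero_mem' := by
    refine ⟨fun _ => 0, IsTest.zero, Lp.coeFn_zero _ _ _, ?_⟩
    refine (Lp.coeFn_zero _ _ _).trans (Eventually.of_forall fun x => ?_)
    simp [tangentialGradient, gradient_fun_const]
  add_mem' := by
    rintro p q ⟨φ, hφ, h1, h2⟩ ⟨ψ, hψ, k1, k2⟩
    refine ⟨fun x => φ x + ψ x, hφ.add hψ, ?_, ?_⟩
    · refine (Lp.coeFn_add p.fst q.fst).trans ?_
      filter_upwards [h1, k1] with x hx kx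
      simp [hx, kx]
    · refine (Lp.coeFn_add p.snd q.snd).trans ?_
      filter_upwards [h2, k2] with x hx kx
      simp [hx, kx, tangentialGradient, hφ.gradient_add hψ]
  smul_mem' := by
    rintro c p ⟨φ, hφ, h1, h2⟩
    refine ⟨fun x => c * φ x, hφ.const_mul c, ?_, ?_⟩
    · refine (Lp.coeFn_smul c p.fst).trans ?_
      filter_upwards [h1] with x hx
      simp [hx]
    · refine (Lp.coeFn_smul c p.snd).trans ?_
      filter_upwards [h2] with x hx
      simp [hx, tangentialGradient, hφ.gradient_const_mul c]

/-- `V_Γ = H¹(Γ)`: the completion of the smooth functions on the compact hypersurface `Γ` in the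
norm `‖v‖² + ‖∇_Γ v‖²`, realized in `L²(Γ) × L²(Γ)ᵈ`; an element is the pair `(v, ∇_Γ v)`. -/
def VBdry {d : ℕ} (Ω : Set (Euc d)) :
    Submodule ℝ (WithLp 2 (HBdry Ω × Lp (Euc d) 2 (surfaceMeasure Ω))) :=
  (smoothBdry Ω).topologicalClosure

/-- The inclusion `V_Γ → H_Γ`. -/
def VBdry.val {d : ℕ} {Ω : Set (Euc d)} : VBdry Ω →L[ℝ] HBdry Ω :=
  (WithLp.fstL 2 ℝ (HBdry Ω) (Lp (Euc d) 2 (surfaceMeasure Ω))).comp (VBdry Ω).subtypeL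

/-- The surface gradient `∇_Γ : V_Γ → L²(Γ)ᵈ`. -/
def VBdry.grad {d : ℕ} {Ω : Set (Euc d)} : VBdry Ω →L[ℝ] Lp (Euc d) 2 (surfaceMeasure Ω) :=
  (WithLp.sndL 2 ℝ (HBdry Ω) (Lp (Euc d) 2 (surfaceMeasure Ω))).comp (VBdry Ω).subtypeL

/-! ### Traces -/

/-- `g ∈ L²(Γ)` is the trace `w|_Γ` of `w ∈ H¹(Ω)`. The trace operator is the continuous
extension to `H¹(Ω)` of the restriction `φ ↦ φ|_Γ` of functions `φ` smooth up to the boundary,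
so its graph is the closure in `H¹(Ω) × L²(Γ)` of the set of pairs `(φ|_Ω, φ|_Γ)`. -/
def IsTrace {d : ℕ} {Ω : Set (Euc d)} (w : VBulk Ω) (g : HBdry Ω) : Prop :=
  (w, g) ∈ closure {p : VBulk Ω × HBdry Ω | ∃ φ : Euc d → ℝ, IsTest φ ∧
    VBulk.val p.1 =ᵐ[bulkMeasure Ω] φ ∧ VBulk.grad p.1 =ᵐ[bulkMeasure Ω] ∇ φ ∧
    p.2 =ᵐ[surfaceMeasure Ω] φ}

/-! ### Time derivatives and initial values -/

/-- For a continuous linear map `ι : X → K` into a Hilbert space, the map `K ≅ K* → X*`,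
`k ↦ (x ↦ ⟪k, ι x⟫)`; for an inclusion `X ⊂ K` this is the embedding `K ⊂ X*` of the triplet
`X ⊂ K ⊂ X*`. -/
def pivot {X K : Type} [NormedAddCommGroup X] [NormedSpace ℝ X] [NormedAddCommGroup K]
    [InnerProductSpace ℝ K] (ι : X →L[ℝ] K) : K →L[ℝ] StrongDual ℝ X :=
  ((ContinuousLinearMap.compL ℝ X K ℝ).flip ι).comp (innerSL ℝ)

/-- `y'` is the weak derivative of `y` on `(0,T)`, both with values in a Banach space `Y`. -/
def IsWeakTimeDeriv {Y : Type} [NormedAddCommGroup Y] [NormedSpace ℝ Y] (T : ℝ)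
    (y y' : ℝ → Y) : Prop :=
  ∀ φ : ℝ → ℝ, ContDiff ℝ ∞ φ → HasCompactSupport φ → tsupport φ ⊆ Ioo 0 T →
    ∫ t in Ioo 0 T, deriv φ t • y t = - ∫ t in Ioo 0 T, φ t • y' t

/-- `y(0) = y₀` for (the representative in `C⁰([0,T];K)` of) the class `y` of functions on
`(0,T)` with values in `K`. -/
def HasInitialValue {K : Type} [NormedAddCommGroup K] (T : ℝ) (y : ℝ → K) (y₀ : K) : Prop :=
  ∃ Y : ℝ → K, ContinuousOn Y (Icc 0 T) ∧ (∀ᵐ t ∂timeMeasure T, Y t = y t) ∧ Y 0 = y₀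

/-! ### The nonlinearities -/

/-- The class of potentials: convex, proper, lower semicontinuous, nonnegative (with the value
`+∞` allowed) and vanishing at `0`. -/
structure IsPotential (b : ℝ → ℝ≥0∞) : Prop where
  convex : ∀ r s a c : ℝ, 0 ≤ a → 0 ≤ c → a + c = 1 →
    b (a * r + c * s) ≤ ENNReal.ofReal a * b r + ENNReal.ofReal c * b s
  proper : ∃ r, b r ≠ ⊤
  lsc : LowerSemicontinuous b
  zero : b 0 = 0

/-- The subdifferential `∂b(r)` of a proper convex function `b : ℝ → [0,+∞]`. -/
def subdiff (b : ℝ → ℝ≥0∞) (r : ℝ) : Set ℝ :=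
  {s | ∀ y : ℝ, (b r : EReal) + ((s * (y - r) : ℝ) : EReal) ≤ (b y : EReal)}

/-! ### The variational problem -/

/-- `(u, v, ξ, ξ_Γ)` solves the variational problem with potentials `b`, `bΓ`, perturbations
`π`, `πΓ`, parameter `ν` and data `f`, `fΓ`, `u₀`, `v₀`. -/
def IsSolution {d : ℕ} (Ω : Set (Euc d)) (T ν : ℝ) (b bΓ : ℝ → ℝ≥0∞) (π πΓ : ℝ → ℝ)
    (f : L2Time T (HBulk Ω)) (fΓ : L2Time T (HBdry Ω)) (u₀ : HBulk Ω) (v₀ : HBdry Ω)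
    (u : L2Time T (VBulk Ω)) (v : L2Time T (VBdry Ω))
    (ξ : L2Time T (HBulk Ω)) (ξΓ : L2Time T (HBdry Ω)) : Prop :=
  (∀ᵐ t ∂timeMeasure T, IsTrace (u t) (VBdry.val (v t))) ∧
  (∀ᵐ t ∂timeMeasure T, ∀ᵐ x ∂bulkMeasure Ω, ξ t x ∈ subdiff b (VBulk.val (u t) x)) ∧
  (∀ᵐ t ∂timeMeasure T, ∀ᵐ x ∂surfaceMeasure Ω, ξΓ t x ∈ subdiff bΓ (VBdry.val (v t) x)) ∧
  HasInitialValue T (fun t => VBulk.val (u t)) u₀ ∧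
  HasInitialValue T (fun t => VBdry.val (v t)) v₀ ∧
  ∃ (u' : L2Time T (StrongDual ℝ (VBulk Ω))) (v' : L2Time T (StrongDual ℝ (VBdry Ω))),
    IsWeakTimeDeriv T (fun t => pivot VBulk.val (VBulk.val (u t))) u' ∧
    IsWeakTimeDeriv T (fun t => pivot VBdry.val (VBdry.val (v t))) v' ∧
    ∀ᵐ t ∂timeMeasure T, ∀ (z : VBulk Ω) (zΓ : VBdry Ω), IsTrace z (VBdry.val zΓ) →
      u' t z + (∫ x, ⟪VBulk.grad (u t) x, VBulk.grad z x⟫ ∂bulkMeasure Ω)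
        + (∫ x, (ξ t x + π (VBulk.val (u t) x)) * VBulk.val z x ∂bulkMeasure Ω)
        + v' t zΓ
        + ν * (∫ x, ⟪VBdry.grad (v t) x, VBdry.grad zΓ x⟫ ∂surfaceMeasure Ω)
        + (∫ x, (ξΓ t x + πΓ (VBdry.val (v t) x)) * VBdry.val zΓ x ∂surfaceMeasure Ω)
      = (∫ x, f t x * VBulk.val z x ∂bulkMeasure Ω)
        + (∫ x, fΓ t x * VBdry.val zΓ x ∂surfaceMeasure Ω)

end AllenCahn

end

/-!
The difference `(w, g) = (u₁ - u₂, v₁ - v₂)` of two solutions is an admissible test pair at almost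
every time. Testing the difference of the two equations with it, and using that subdifferentials
are monotone and that `π`, `πΓ` are Lipschitz, gives (`WeakForm.energy_le`)
`⟨w', w⟩ + ⟨g', g⟩ ≤ (L + LΓ) (‖w‖² + ‖g‖²) - (‖∇w‖² + ν ‖∇_Γ g‖²)`.

To integrate this in time one needs only half of the Lions-Magenes identity, the inequality
`‖w(τ)‖² ≤ 2 ∫₀^τ ⟨w', w⟩` for `w(0) = 0`, proved in `sq_norm_le_two_mul_integral` from difference
quotients in time and the continuity of translations in `L²`. Grönwall's lemma then gives
`w = 0` in `L²(Ω)` and `g = 0` in `L²(Γ)`. The dissipation term which was kept on the right side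
gives `∇w = 0` and `∇_Γ g = 0` (`ae_eq_zero_of_dissipation`); in particular, it is not needed that a
weak surface gradient is determined by its function.

The equations now differ only in the selections, so that
`∫_Ω (ξ₁ - ξ₂) φ + ∫_Γ (ξΓ₁ - ξΓ₂) φ = 0` for all test functions `φ`, and `WeakForm.selection_eq`
concludes. That test functions are admissible requires their tangential gradients to be square
integrable on `Γ`. Near a boundary point `Γ` is the zero set of a smooth function `F`, whose tangent
cones are the kernels of the derivatives of `F`, so tangential gradients are continuous on `Γ`; and
the surface measure is finite because `Γ` is compact and locally a Lipschitz graph.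
-/

namespace AllenCahn

/-! ### Weak time derivatives -/

/-- A weak derivative of the zero function vanishes. -/
theorem IsWeakTimeDeriv.ae_eq_zero {Y : Type} [NormedAddCommGroup Y] [NormedSpace ℝ Y]
    [CompleteSpace Y] {T : ℝ} {y y' : ℝ → Y} (h : IsWeakTimeDeriv T y y')
    (hy : ∀ᵐ t ∂timeMeasure T, y t = 0) (hy' : MemLp y' 2 (timeMeasure T)) :
    ∀ᵐ t ∂timeMeasure T, y' t = 0 := by
  have hi : IntegrableOn y' (Ioo 0 T) := hy'.integrable one_le_two
  rw [ae_restrict_iff' measurableSet_Ioo]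
  refine isOpen_Ioo.ae_eq_zero_of_integral_contDiff_smul_eq_zero
    hi.locallyIntegrableOn fun φ hφ hc hs => ?_
  have h1 := h φ hφ hc hs
  have h2 : ∫ t in Ioo 0 T, deriv φ t • y t = 0 := by
    rw [← integral_zero ℝ Y (μ := timeMeasure T)]
    refine integral_congr_ae ?_
    filter_upwards [hy] with t ht
    rw [ht, smul_zero]
  rw [h2, eq_comm, neg_eq_zero] at h1
  rw [← h1, setIntegral_eq_integral_of_forall_compl_eq_zero]
  intro t ht
  rw [image_eq_zero_of_notMem_tsupport fun h => ht (hs h), zero_smul]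

theorem deriv_smoothTransition_eq_zero {q : ℝ} (hq : q ∉ Icc (0 : ℝ) 1) :
    deriv Real.smoothTransition q = 0 := by
  rw [mem_Icc, not_and_or, not_le, not_le] at hq
  rcases hq with hq | hq
  · have : Real.smoothTransition =ᶠ[𝓝 q] fun _ => 0 := by
      filter_upwards [gt_mem_nhds hq] with r hr using Real.smoothTransition.zero_of_nonpos hr.le
    rw [this.deriv_eq, deriv_const]
  · have : Real.smoothTransition =ᶠ[𝓝 q] fun _ => 1 := by
      filter_upwards [lt_mem_nhds hq] with r hr using Real.smoothTransition.one_of_one_le hr.le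
    rw [this.deriv_eq, deriv_const]

theorem hasCompactSupport_deriv_smoothTransition :
    HasCompactSupport (deriv Real.smoothTransition) :=
  HasCompactSupport.intro isCompact_Icc fun _ h => deriv_smoothTransition_eq_zero h

theorem continuous_deriv_smoothTransition : Continuous (deriv Real.smoothTransition) :=
  (Real.smoothTransition.contDiff (n := 1)).continuous_deriv_one

theorem integral_deriv_smoothTransition : ∫ q, deriv Real.smoothTransition q = 1 := by
  have h := integral_of_hasDerivAt_of_tendsto (f := Real.smoothTransition) (m := 0) (n := 1)
    (fun q => ((Real.smoothTransition.contDiff (n := 1)).differentiable (by simp) q).hasDerivAt)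
    (continuous_deriv_smoothTransition.integrable_of_hasCompactSupport
      hasCompactSupport_deriv_smoothTransition)
    (tendsto_const_nhds.congr' (by
      filter_upwards [eventually_le_atBot (0 : ℝ)] with q hq
      rw [Real.smoothTransition.zero_of_nonpos hq]))
    (tendsto_const_nhds.congr' (by
      filter_upwards [eventually_ge_atTop (1 : ℝ)] with q hq
      rw [Real.smoothTransition.one_of_one_le hq]))
  rw [h, sub_zero]

/-- The derivatives of the smoothed jumps `r ↦ S (n (r - s))`, with `S = Real.smoothTransition`,
concentrate at `s`. -/
theorem tendsto_integral_deriv_smoothTransition {E : Type*} [NormedAddCommGroup E]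
    [NormedSpace ℝ E] [CompleteSpace E] {m : ℝ → E} (hm : Continuous m) {C : ℝ}
    (hC : ∀ r, ‖m r‖ ≤ C) (s : ℝ) :
    Tendsto (fun n : ℝ => ∫ r, (n * deriv Real.smoothTransition (n * (r - s))) • m r) atTop
      (𝓝 (m s)) := by
  have hint := continuous_deriv_smoothTransition.integrable_of_hasCompactSupport (μ := volume)
      hasCompactSupport_deriv_smoothTransition
  have hlim : Tendsto (fun n : ℝ => ∫ q, deriv Real.smoothTransition q • m (n⁻¹ * q + s)) atTop
      (𝓝 (∫ q, deriv Real.smoothTransition q • m s)) := by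
    refine tendsto_integral_filter_of_dominated_convergence
      (fun q => ‖deriv Real.smoothTransition q‖ * C) (Eventually.of_forall fun n => ?_)
      (Eventually.of_forall fun n => Eventually.of_forall fun q => ?_) (hint.norm.mul_const C)
      (Eventually.of_forall fun q => ?_)
    · exact (continuous_deriv_smoothTransition.smul
        (hm.comp (by fun_prop))).aestronglyMeasurable
    · rw [norm_smul]
      exact mul_le_mul_of_nonneg_left (hC _) (norm_nonneg _)
    · refine tendsto_const_nhds.smul ((hm.tendsto s).comp ?_)
      simpa using (tendsto_inv_atTop_zero.mul_const q).add_const s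
  rw [integral_smul_const, integral_deriv_smoothTransition, one_smul] at hlim
  refine hlim.congr' ?_
  filter_upwards [eventually_gt_atTop (0 : ℝ)] with n hn
  have h1 : ∫ r, (n * deriv Real.smoothTransition (n * (r - s))) • m r
      = ∫ r, n • (deriv Real.smoothTransition (n * r) • m (r + s)) := by
    rw [← integral_add_right_eq_self _ s]
    simp only [add_sub_cancel_right, mul_smul]
  have h2 := Measure.integral_comp_mul_left
    (fun q => deriv Real.smoothTransition q • m (n⁻¹ * q + s)) n
  have h3 : ∀ r, n⁻¹ * (n * r) + s = r + s := fun r => by field_simp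
  simp only [h3] at h2
  rw [h1, integral_smul, h2, abs_of_pos (inv_pos.2 hn), smul_smul, mul_inv_cancel₀ hn.ne', one_smul]

/-- The fundamental theorem of calculus for weak derivatives: a continuous representative is the
primitive of the weak derivative. The test functions are smooth approximations of the indicator
functions of intervals. -/
theorem IsWeakTimeDeriv.eq_add_integral {Y : Type} [NormedAddCommGroup Y] [NormedSpace ℝ Y]
    [CompleteSpace Y] {T : ℝ} (hT : 0 < T) {y y' A : ℝ → Y} (h : IsWeakTimeDeriv T y y')
    (hy' : IntegrableOn y' (Ioo 0 T)) (hA : ContinuousOn A (Icc 0 T))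
    (hAy : ∀ᵐ t ∂timeMeasure T, A t = y t) {t : ℝ} (ht : t ∈ Icc 0 T) :
    A t = A 0 + ∫ r in (0 : ℝ)..t, y' r := by
  let m : ℝ → Y := IccExtend hT.le ((Icc 0 T).domRestrict A)
  have hm : Continuous m := (continuousOn_iff_continuous_domRestrict.1 hA).Icc_extend'
  have hmA : ∀ r ∈ Icc 0 T, m r = A r := fun r hr => IccExtend_of_mem hT.le _ hr
  obtain ⟨C, hC⟩ : ∃ C, ∀ r, ‖m r‖ ≤ C := by
    obtain ⟨C, hC⟩ := isCompact_Icc.exists_bound_of_continuousOn hA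
    exact ⟨C, fun r => hC _ (projIcc 0 T hT.le r).2⟩
  have hy'i : IntegrableOn y' (Icc 0 T) := by rwa [integrableOn_Icc_iff_integrableOn_Ioo]
  have hii : ∀ a ∈ Icc 0 T, ∀ b ∈ Icc 0 T, IntervalIntegrable y' volume a b := fun a ha b hb =>
    (hy'i.mono_set (uIcc_subset_Icc ha hb)).intervalIntegrable
  have hSd : Differentiable ℝ Real.smoothTransition :=
    (Real.smoothTransition.contDiff (n := 1)).differentiable (by simp)
  have interior : ∀ s ∈ Ioo 0 T, ∀ t ∈ Ioo 0 T, s ≤ t → A t - A s = ∫ r in s..t, y' r := by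
    intro s hs t ht hst
    -- supported in `[s, t + 1 / n]` and tending to the indicator function of `(s, t]`
    let φ : ℝ → ℝ → ℝ := fun n r =>
      Real.smoothTransition (n * (r - s)) - Real.smoothTransition (n * (r - t))
    have hφ : ∀ n, ContDiff ℝ ∞ (φ n) := fun n =>
      (Real.smoothTransition.contDiff.comp (by fun_prop)).sub
        (Real.smoothTransition.contDiff.comp (by fun_prop))
    have hφ' : ∀ n r, deriv (φ n) r = n * deriv Real.smoothTransition (n * (r - s))
        - n * deriv Real.smoothTransition (n * (r - t)) := by
      intro n r
      have k : ∀ a : ℝ, HasDerivAt (fun r : ℝ => n * (r - a)) n r := fun a => by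
        simpa using ((hasDerivAt_id r).sub_const a).const_mul n
      have := ((hSd (n * (r - s))).hasDerivAt.comp r (k s)).sub
        ((hSd (n * (r - t))).hasDerivAt.comp r (k t))
      exact this.deriv.trans (by ring)
    have hsupp : ∀ᶠ n : ℝ in atTop, 0 < n ∧ tsupport (φ n) ⊆ Icc s ((t + T) / 2) := by
      filter_upwards [eventually_gt_atTop 0, eventually_ge_atTop (2 / (T - t))] with n hn hn'
      refine ⟨hn, closure_minimal (fun r hr => ?_) isClosed_Icc⟩
      by_contra hr'
      refine hr ?_
      rw [mem_Icc, not_and_or, not_le, not_le] at hr'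
      have hTt : 0 < T - t := by linarith [ht.2]
      rw [div_le_iff₀ hTt] at hn'
      change Real.smoothTransition _ - Real.smoothTransition _ = 0
      rcases hr' with hr' | hr'
      · rw [Real.smoothTransition.zero_of_nonpos, Real.smoothTransition.zero_of_nonpos, sub_zero]
          <;> nlinarith
      · rw [Real.smoothTransition.one_of_one_le, Real.smoothTransition.one_of_one_le, sub_self]
          <;> nlinarith
    have hIcc : Icc s ((t + T) / 2) ⊆ Ioo 0 T := fun r hr =>
      ⟨hs.1.trans_le hr.1, by linarith [hr.2, ht.2]⟩
    have hleft : Tendsto (fun n : ℝ => ∫ r in Ioo 0 T, deriv (φ n) r • y r) atTop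
        (𝓝 (m s - m t)) := by
      refine ((tendsto_integral_deriv_smoothTransition hm hC s).sub
        (tendsto_integral_deriv_smoothTransition hm hC t)).congr' ?_
      filter_upwards [hsupp] with n hn
      have hi : ∀ a, Integrable
          (fun r => (n * deriv Real.smoothTransition (n * (r - a))) • m r) := by
        intro a
        refine Continuous.integrable_of_hasCompactSupport
          ((continuous_const.mul (continuous_deriv_smoothTransition.comp (by fun_prop))).smul hm) ?_
        refine HasCompactSupport.intro (isCompact_Icc (a := a) (b := a + n⁻¹)) fun r hr => ?_
        rw [deriv_smoothTransition_eq_zero, mul_zero, zero_smul]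
        rintro ⟨h1, h2⟩
        have h3 : 0 ≤ r - a := nonneg_of_mul_nonneg_right h1 hn.1
        have h4 : r - a ≤ n⁻¹ := by
          rw [← one_div, le_div_iff₀ hn.1]; linarith
        exact hr ⟨by linarith, by linarith⟩
      rw [← integral_sub (hi s) (hi t)]
      have e1 : ∫ r in Ioo 0 T, deriv (φ n) r • y r = ∫ r in Ioo 0 T, deriv (φ n) r • m r := by
        refine integral_congr_ae ?_
        filter_upwards [hAy, ae_restrict_mem measurableSet_Ioo] with r hr hr'
        rw [hmA r (Ioo_subset_Icc_self hr'), hr]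
      rw [e1, setIntegral_eq_integral_of_forall_compl_eq_zero]
      · refine integral_congr_ae (Eventually.of_forall fun r => ?_)
        simp only [hφ', sub_smul]
      · intro r hr
        have h0 : deriv (φ n) r = 0 := image_eq_zero_of_notMem_tsupport
          fun h' => hr (hIcc (hn.2 (tsupport_deriv_subset h')))
        rw [h0, zero_smul]
    have hright : Tendsto (fun n : ℝ => ∫ r in Ioo 0 T, φ n r • y' r) atTop
        (𝓝 (∫ r in Ioo 0 T, (Ioc s t).indicator y' r)) := by
      refine tendsto_integral_filter_of_dominated_convergence (fun r => ‖y' r‖)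
        (Eventually.of_forall fun n => (hφ n).continuous.aestronglyMeasurable.smul hy'.1)
        (Eventually.of_forall fun n => Eventually.of_forall fun r => ?_) hy'.norm
        (Eventually.of_forall fun r => ?_)
      · rw [norm_smul]
        refine mul_le_of_le_one_left (norm_nonneg _) ?_
        rw [Real.norm_eq_abs, abs_le]
        have := Real.smoothTransition.nonneg (n * (r - s))
        have := Real.smoothTransition.nonneg (n * (r - t))
        have := Real.smoothTransition.le_one (n * (r - s))
        have := Real.smoothTransition.le_one (n * (r - t))
        constructor <;> simp only [φ] <;> linarith
      · have hone : ∀ a, a < r →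
            ∀ᶠ n : ℝ in atTop, Real.smoothTransition (n * (r - a)) = 1 := fun a ha => by
          filter_upwards [eventually_ge_atTop (1 / (r - a))] with n hn
          rw [div_le_iff₀ (by linarith)] at hn
          exact Real.smoothTransition.one_of_one_le hn
        have hzero : ∀ a, r ≤ a →
            ∀ᶠ n : ℝ in atTop, Real.smoothTransition (n * (r - a)) = 0 := fun a ha => by
          filter_upwards [eventually_ge_atTop 0] with n hn
          exact Real.smoothTransition.zero_of_nonpos (mul_nonpos_of_nonneg_of_nonpos hn (by linarith))
        refine tendsto_const_nhds.congr' ?_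
        by_cases h1 : s < r
        · by_cases h2 : r ≤ t
          · filter_upwards [hone s h1, hzero t h2] with n k1 k2
            simp [φ, k1, k2, indicator_of_mem (show r ∈ Ioc s t from ⟨h1, h2⟩)]
          · filter_upwards [hone s h1, hone t (not_le.1 h2)] with n k1 k2
            simp [φ, k1, k2, h2]
        · have h2 : r ≤ s := not_lt.1 h1
          filter_upwards [hzero s h2, hzero t (h2.trans hst)] with n k1 k2
          simp [φ, k1, k2, h1]
    have heq : m s - m t = -∫ r in Ioo 0 T, (Ioc s t).indicator y' r := by
      refine tendsto_nhds_unique hleft (hright.neg.congr' ?_)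
      filter_upwards [hsupp] with n hn
      exact (h (φ n) (hφ n) (isCompact_Icc.of_isClosed_subset (isClosed_tsupport _) hn.2)
        (hn.2.trans hIcc)).symm
    rw [setIntegral_indicator measurableSet_Ioc, inter_eq_right.2
      (show Ioc s t ⊆ Ioo 0 T from fun r hr => ⟨hs.1.trans hr.1, hr.2.trans_lt ht.2⟩),
      hmA s (Ioo_subset_Icc_self hs), hmA t (Ioo_subset_Icc_self ht)] at heq
    rw [intervalIntegral.integral_of_le hst, ← neg_sub, heq, neg_neg]
  have h0 : (0 : ℝ) ∈ Icc 0 T := left_mem_Icc.2 hT.le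
  have hB : ContinuousOn (fun t => A t - ∫ r in (0 : ℝ)..t, y' r) (Icc 0 T) := by
    refine hA.sub ?_
    have := intervalIntegral.continuousOn_primitive_interval (μ := volume) (f := y')
      (a := 0) (b := T) (by rwa [uIcc_of_le hT.le])
    rwa [uIcc_of_le hT.le] at this
  let c : ℝ := T / 2
  have hc : c ∈ Ioo 0 T := ⟨by simp only [c]; linarith, by simp only [c]; linarith⟩
  have hconst : EqOn (fun t => A t - ∫ r in (0 : ℝ)..t, y' r)
      (fun _ => A c - ∫ r in (0 : ℝ)..c, y' r) (Icc 0 T) := by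
    refine EqOn.of_subset_closure (s := Ioo 0 T) (fun t ht => ?_) hB continuousOn_const
      Ioo_subset_Icc_self (by rw [closure_Ioo hT.ne])
    have hadd := intervalIntegral.integral_add_adjacent_intervals
      (hii 0 h0 c (Ioo_subset_Icc_self hc))
      (hii c (Ioo_subset_Icc_self hc) t (Ioo_subset_Icc_self ht))
    have hct : A t - A c = ∫ r in c..t, y' r := by
      rcases le_total c t with hle | hle
      · exact interior c hc t ht hle
      · rw [intervalIntegral.integral_symm, ← interior t ht c hc hle, neg_sub]
    change A t - _ = A c - _
    rw [← hadd, ← hct]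
    abel
  have e1 := hconst ht
  have e2 := hconst h0
  simp only [intervalIntegral.integral_same, sub_zero] at e1 e2
  rw [e2, ← e1]
  abel

/-- Grönwall's lemma in integral form, without initial term. -/
theorem eq_zero_of_le_mul_integral {T C : ℝ} {E : ℝ → ℝ} (hE : ContinuousOn E (Icc 0 T))
    (hpos : ∀ t ∈ Icc 0 T, 0 ≤ E t) (hle : ∀ t ∈ Icc 0 T, E t ≤ C * ∫ r in (0 : ℝ)..t, E r)
    {t : ℝ} (ht : t ∈ Icc 0 T) : E t = 0 := by
  have hT : 0 ≤ T := ht.1.trans ht.2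
  have hcont : ContinuousOn (fun t => ∫ r in (0 : ℝ)..t, E r) (Icc 0 T) := by
    have := intervalIntegral.continuousOn_primitive_interval (μ := volume) (f := E)
      (a := 0) (b := T) (by rw [uIcc_of_le hT]; exact hE.integrableOn_Icc)
    rwa [uIcc_of_le hT] at this
  have hzero := eq_zero_of_abs_deriv_le_mul_abs_self_of_eq_zero_right (K := C) (f' := E) hcont
    (fun x hx => by
      have hmem : Icc 0 T ∈ 𝓝[≥] x := by
        refine mem_of_superset (Icc_mem_nhdsGE hx.2) (Icc_subset_Icc_left hx.1)
      have hcx : ContinuousWithinAt E (Ici x) x :=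
        (hE x (Ico_subset_Icc_self hx)).mono_of_mem_nhdsWithin hmem
      refine intervalIntegral.integral_hasDerivWithinAt_right
        ((hE.mono (Icc_subset_Icc_right hx.2.le)).intervalIntegrable_of_Icc hx.1)
        (t := Ioi x) ?_ (hcx.mono Ioi_subset_Ici_self)
      exact ⟨Icc 0 T, mem_of_superset (nhdsWithin_mono x Ioi_subset_Ici_self hmem) subset_rfl,
        hE.aestronglyMeasurable measurableSet_Icc⟩)
    intervalIntegral.integral_same
    (fun x hx => by
      have hx' := Ico_subset_Icc_self hx
      rw [Real.norm_of_nonneg (hpos x hx'), Real.norm_of_nonneg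
        (intervalIntegral.integral_nonneg hx.1 fun r hr => hpos r ⟨hr.1, hr.2.trans hx'.2⟩)]
      exact hle x hx')
  refine le_antisymm ?_ (hpos t ht)
  have := hle t ht
  rwa [hzero t ht, mul_zero] at this

/-! ### The energy inequality -/

/-- Pairing a square integrable function with the translates of another one gives a continuous
function of the translation. -/
theorem continuous_integral_translate {X : Type*} [NormedAddCommGroup X] [NormedSpace ℝ X]
    {D : ℝ → StrongDual ℝ X} {g : ℝ → X} (hD : MemLp D 2) (hg : MemLp g 2) :
    Continuous fun θ : ℝ => ∫ t, D (t - θ) (g t) := by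
  let τ : ℝ → C(ℝ, ℝ) := fun θ => ⟨fun t => t - θ, by fun_prop⟩
  have hτ : Continuous τ :=
    ContinuousMap.continuous_of_continuous_uncurry _ (continuous_snd.sub continuous_fst)
  have hτm : ∀ θ, MeasurePreserving (τ θ) volume volume := fun θ =>
    measurePreserving_sub_right volume θ
  have h1 : Continuous fun θ => Lp.compMeasurePreserving (τ θ) (hτm θ) (hD.toLp D) :=
    continuous_const.compMeasurePreservingLp hτ hτm (by simp)
  have h2 := ((ContinuousLinearMap.id ℝ (StrongDual ℝ X)).lpPairing volume 2 2).flip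
    (hg.toLp g) |>.continuous.comp h1
  refine h2.congr fun θ => ?_
  simp only [Function.comp_apply, ContinuousLinearMap.flip_apply]
  rw [ContinuousLinearMap.lpPairing_eq_integral]
  refine integral_congr_ae ?_
  filter_upwards [Lp.coeFn_compMeasurePreserving (hD.toLp D) (hτm θ), hg.coeFn_toLp,
    (hτm θ).quasiMeasurePreserving.ae_eq_comp hD.coeFn_toLp] with t h1 h2 h3
  rw [h1, h2, h3]
  rfl

theorem pivot_apply {X K : Type} [NormedAddCommGroup X] [NormedSpace ℝ X] [NormedAddCommGroup K]
    [InnerProductSpace ℝ K] (ι : X →L[ℝ] K) (k : K) (x : X) : pivot ι k x = ⟪k, ι x⟫ := rfl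

theorem memLp_integrable_indicator {E : Type*} [NormedAddCommGroup E] {f : ℝ → E} {s : Set ℝ}
    (hs : MeasurableSet s) (hf : MemLp f 2 (volume.restrict s)) (hs' : volume s ≠ ⊤) :
    MemLp (s.indicator f) 2 ∧ Integrable (s.indicator f) := by
  have : IsFiniteMeasure (volume.restrict s) := ⟨by simpa using hs'.lt_top⟩
  exact ⟨(memLp_indicator_iff_restrict hs).2 hf,
    (integrable_indicator_iff hs).2 (hf.integrable one_le_two)⟩

/-- The inequality `‖y(τ)‖² ≤ 2 ∫₀^τ ⟨y', y⟩` of Lions and Magenes, for `y` with values in `X`,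
with `y(0) = 0` in `K` and a weak derivative `y'` with values in `X*`.

With `Y` the continuous representative extended by zero to negative times, the inequality
`‖Y(t)‖² - ‖Y(t - h)‖² ≤ 2 ⟪Y(t) - Y(t - h), Y(t)⟫` is averaged over `t ∈ (0, τ)`. The right side
becomes the average over `θ ∈ (0, h)` of the pairings of `y` with the translates `y'(· - θ)`,
which are continuous in `θ`. -/
theorem sq_norm_le_two_mul_integral {X K : Type} [NormedAddCommGroup X] [NormedSpace ℝ X]
    [NormedAddCommGroup K] [InnerProductSpace ℝ K] (ι : X →L[ℝ] K) {T : ℝ} (hT : 0 < T)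
    {y : ℝ → X} {y' : ℝ → StrongDual ℝ X} {Y : ℝ → K}
    (hy : MemLp y 2 (timeMeasure T)) (hy' : MemLp y' 2 (timeMeasure T))
    (h : IsWeakTimeDeriv T (fun t => pivot ι (ι (y t))) y')
    (hY : ContinuousOn Y (Icc 0 T)) (hYy : ∀ᵐ t ∂timeMeasure T, Y t = ι (y t)) (hY0 : Y 0 = 0)
    {τ : ℝ} (hτ : τ ∈ Icc 0 T) :
    ‖Y τ‖ ^ 2 ≤ 2 * ∫ t in Ioo 0 τ, y' t (y t) := by
  let Ye : ℝ → K := IccExtend hT.le ((Icc 0 T).domRestrict Y)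
  have hYe : Continuous Ye := (continuousOn_iff_continuous_domRestrict.1 hY).Icc_extend'
  have hYeY : ∀ r ∈ Icc 0 T, Ye r = Y r := fun r hr => IccExtend_of_mem hT.le _ hr
  -- since `Y 0 = 0`, the constant extension of `Y` to negative times is the extension by zero
  have hYe0 : ∀ r ≤ 0, Ye r = 0 := fun r hr => by
    rw [← hY0]; exact IccExtend_of_le_left hT.le _ hr
  let D : ℝ → StrongDual ℝ X := (Ioo 0 T).indicator y'
  let g : ℝ → X := (Ioo 0 τ).indicator y
  have hsub : Ioo 0 τ ⊆ Ioo 0 T := Ioo_subset_Ioo_right hτ.2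
  obtain ⟨hD, hD1⟩ : MemLp D 2 ∧ Integrable D :=
    memLp_integrable_indicator measurableSet_Ioo hy' (by simp)
  obtain ⟨hg, hg1⟩ : MemLp g 2 ∧ Integrable g :=
    memLp_integrable_indicator measurableSet_Ioo
      (hy.mono_measure (Measure.restrict_mono hsub le_rfl)) (by simp)
  -- `Y` is the primitive of `D`
  have hprim : ∀ t ≤ T, pivot ι (Ye t) = ∫ r in (0 : ℝ)..t, D r := by
    intro t ht
    rcases le_total t 0 with h0 | h0
    · rw [hYe0 t h0, map_zero, intervalIntegral.integral_symm, intervalIntegral.integral_of_le h0,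
        eq_comm, neg_eq_zero]
      refine setIntegral_eq_zero_of_forall_eq_zero fun r hr => ?_
      have hr' : r ∉ Ioo 0 T := fun h' => absurd h'.1 (not_lt.2 hr.2)
      exact indicator_of_notMem hr' y'
    · have hFTC := h.eq_add_integral hT (hy'.integrable (by norm_num))
        (A := fun t => pivot ι (Y t)) ((pivot ι).continuous.comp_continuousOn hY)
        (by filter_upwards [hYy] with r hr; rw [hr]) ⟨h0, ht⟩
      rw [hYeY t ⟨h0, ht⟩]
      refine hFTC.trans ?_
      rw [hY0, map_zero, zero_add, intervalIntegral.integral_of_le h0,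
        intervalIntegral.integral_of_le h0, integral_Ioc_eq_integral_Ioo,
        integral_Ioc_eq_integral_Ioo]
      refine setIntegral_congr_fun measurableSet_Ioo fun r hr => ?_
      have hr' : r ∈ Ioo 0 T := ⟨hr.1, hr.2.trans_le ht⟩
      exact (indicator_of_mem hr' y').symm
  have hdiff : ∀ t ≤ T, ∀ k : ℝ, 0 ≤ k →
      pivot ι (Ye t - Ye (t - k)) = ∫ θ in (0 : ℝ)..k, D (t - θ) := by
    intro t ht k hk
    rw [map_sub, hprim t ht, hprim (t - k) (by linarith),
      intervalIntegral.integral_interval_sub_left hD1.intervalIntegrable hD1.intervalIntegrable,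
      intervalIntegral.integral_comp_sub_left (fun r => D r), sub_zero]
  -- the pairing of `y` on `(0, τ)` with the translate of `y'` by `θ`
  let p : ℝ → ℝ := fun θ => ∫ t, D (t - θ) (g t)
  have hp : Continuous p := continuous_integral_translate hD hg
  -- `p` is the convolution of `g` with the reflection of `D`
  have hconv : Integrable (fun q : ℝ × ℝ => D (q.2 - q.1) (g q.2)) (volume.prod volume) := by
    have := Integrable.convolution_integrand
      (ContinuousLinearMap.id ℝ (StrongDual ℝ X)).flip hg1 hD1.comp_neg
    simpa using this
  have hfub : ∀ k : ℝ, ∫ θ in (0 : ℝ)..k, p θ = ∫ t, (∫ θ in (0 : ℝ)..k, D (t - θ)) (g t) := by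
    intro k
    have hi : Integrable (Function.uncurry fun θ t : ℝ => D (t - θ) (g t))
        ((volume.restrict (uIoc 0 k)).prod volume) :=
      hconv.mono_measure (Measure.prod_mono Measure.restrict_le_self le_rfl)
    simp only [p]
    rw [intervalIntegral_integral_swap hi]
    refine integral_congr_ae (Eventually.of_forall fun t => ?_)
    exact (ContinuousLinearMap.intervalIntegral_apply
      (hD1.comp_sub_left t).intervalIntegrable (g t)).symm
  let N : ℝ → ℝ := fun t => ‖Ye t‖ ^ 2
  have hN : Continuous N := hYe.norm.pow 2
  have hineq : ∀ k : ℝ, 0 < k → ∫ t in (τ - k)..τ, N t ≤ 2 * ∫ θ in (0 : ℝ)..k, p θ := by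
    intro k hk
    have hNi : ∀ a c, IntervalIntegrable N volume a c := fun a c => hN.intervalIntegrable a c
    have hN0 : ∫ t in (0 - k)..0, N t = 0 := by
      rw [intervalIntegral.integral_of_le (by linarith)]
      refine setIntegral_eq_zero_of_forall_eq_zero fun r hr => ?_
      simp [N, hYe0 r hr.2]
    have hshift : ∫ t in (0 : ℝ)..τ, (N t - N (t - k)) = ∫ t in (τ - k)..τ, N t := by
      rw [intervalIntegral.integral_sub (hNi 0 τ)
        ((by fun_prop : Continuous fun t => N (t - k)).intervalIntegrable 0 τ),
        intervalIntegral.integral_comp_sub_right (fun t => N t)]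
      have a1 := intervalIntegral.integral_add_adjacent_intervals (hNi (0 - k) 0) (hNi 0 τ)
      have a2 := intervalIntegral.integral_add_adjacent_intervals (hNi (0 - k) (τ - k))
        (hNi (τ - k) τ)
      linarith
    rw [← hshift, hfub, ← integral_const_mul, intervalIntegral.integral_of_le hτ.1,
      integral_Ioc_eq_integral_Ioo, ← integral_indicator measurableSet_Ioo]
    refine integral_mono_ae ?_ ?_ ?_
    · refine (integrable_indicator_iff measurableSet_Ioo).2 ?_
      exact (Continuous.integrableOn_Icc (by fun_prop)).mono_set Ioo_subset_Icc_self
    · refine Integrable.const_mul ?_ 2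
      have hi : Integrable (fun q : ℝ × ℝ => D (q.2 - q.1) (g q.2))
          ((volume.restrict (Ioc 0 k)).prod volume) :=
        hconv.mono_measure (Measure.prod_mono Measure.restrict_le_self le_rfl)
      refine hi.integral_prod_right.congr (Eventually.of_forall fun t => ?_)
      simp only
      rw [ContinuousLinearMap.intervalIntegral_apply (hD1.comp_sub_left t).intervalIntegrable,
        intervalIntegral.integral_of_le hk.le]
    · have hYy' := (ae_restrict_iff' measurableSet_Ioo).1 hYy
      filter_upwards [hYy'] with t ht
      by_cases hmem : t ∈ Ioo 0 τ
      · have htT := hsub hmem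
        rw [indicator_of_mem hmem, ← hdiff t htT.2.le k hk.le, pivot_apply]
        have hgt : g t = y t := indicator_of_mem hmem _
        rw [hgt, ← ht htT, ← hYeY t (Ioo_subset_Icc_self htT)]
        have e := norm_sub_sq_real (Ye t) (Ye (t - k))
        have e' : (⟪Ye t - Ye (t - k), Ye t⟫ : ℝ) = ‖Ye t‖ ^ 2 - ⟪Ye t, Ye (t - k)⟫ := by
          rw [inner_sub_left, real_inner_self_eq_norm_sq, real_inner_comm]
        have := sq_nonneg ‖Ye t - Ye (t - k)‖
        simp only [N]
        rw [e']
        linarith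
      · have hgt : g t = 0 := indicator_of_notMem hmem _
        rw [indicator_of_notMem hmem, hgt, map_zero, mul_zero]
  -- divide by `k` and let `k` tend to `0`
  have hder : HasDerivAt (fun k => 2 * (∫ θ in (0 : ℝ)..k, p θ) - ∫ t in (τ - k)..τ, N t)
      (2 * p 0 - N τ) 0 := by
    have d1 : HasDerivAt (fun k => ∫ θ in (0 : ℝ)..k, p θ) (p 0) 0 :=
      hp.integral_hasStrictDerivAt 0 0 |>.hasDerivAt
    have d2 : HasDerivAt (fun a => ∫ t in τ..a, N t) (N τ) (τ - 0) := by
      rw [sub_zero]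
      exact hN.integral_hasStrictDerivAt τ τ |>.hasDerivAt
    have d3 : HasDerivAt (fun k : ℝ => τ - k) (-1) 0 := by
      simpa using (hasDerivAt_id (0 : ℝ)).const_sub τ
    have d4 := d2.comp (0 : ℝ) d3
    have d5 := (d1.const_mul 2).add d4
    refine (d5.congr_deriv (by ring)).congr_of_eventuallyEq (Eventually.of_forall fun k => ?_)
    simp only [Pi.add_apply, Function.comp_apply]
    rw [intervalIntegral.integral_symm τ (τ - k)]
    ring
  have hlim := hder.tendsto_slope_zero_right
  have hnonneg : 0 ≤ 2 * p 0 - N τ := by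
    refine ge_of_tendsto hlim ?_
    filter_upwards [self_mem_nhdsWithin] with k hk
    have hk' : (0 : ℝ) < k := hk
    have := hineq k hk'
    simp only [zero_add, intervalIntegral.integral_same, sub_zero, mul_zero, smul_eq_mul]
    exact mul_nonneg (inv_nonneg.2 hk'.le) (by linarith)
  have hp0 : p 0 = ∫ t in Ioo 0 τ, y' t (y t) := by
    simp only [p, sub_zero]
    rw [← integral_indicator measurableSet_Ioo]
    refine integral_congr_ae (Eventually.of_forall fun t => ?_)
    by_cases hmem : t ∈ Ioo 0 τ
    · simp only [D, g, indicator_of_mem hmem, indicator_of_mem (hsub hmem)]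
    · simp only [g, indicator_of_notMem hmem, map_zero]
  rw [← hp0, ← hYeY τ hτ]
  linarith

/-! ### The boundary as a smooth hypersurface -/

/-- Near a boundary point, the frontier is the zero set of a smooth function `F` which grows at
unit speed in some direction `e`. -/
theorem HasSmoothBoundary.exists_defining_function {d : ℕ} {Ω : Set (Euc d)}
    (hΩ : HasSmoothBoundary Ω) (hopen : IsOpen Ω) {x : Euc d} (hx : x ∈ frontier Ω) :
    ∃ e : Euc d, ‖e‖ = 1 ∧ ∃ F : Euc d → ℝ, ContDiff ℝ ∞ F ∧
      (∀ y (t : ℝ), F (y + t • e) = F y + t) ∧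
      ∃ r > 0, ∀ y ∈ Metric.ball x r, (y ∈ frontier Ω ↔ F y = 0) := by
  obtain ⟨e, he, γ, hγ, r, hr, h⟩ := hΩ x hx
  have hee : ⟪e, e⟫ = (1 : ℝ) := by rw [real_inner_self_eq_norm_sq, he]; norm_num
  have hF : ContDiff ℝ ∞ fun y : Euc d => ⟪e, y⟫ - γ (y - ⟪e, y⟫ • e) := by
    have h1 : ContDiff ℝ ∞ fun y : Euc d => ⟪e, y⟫ := contDiff_const.inner ℝ contDiff_id
    exact h1.sub (hγ.comp (contDiff_id.sub (h1.smul contDiff_const)))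
  have hline : ∀ y (t : ℝ), ⟪e, y + t • e⟫ - γ ((y + t • e) - ⟪e, y + t • e⟫ • e)
      = ⟪e, y⟫ - γ (y - ⟪e, y⟫ • e) + t := by
    intro y t
    have h2 : (⟪e, y + t • e⟫ : ℝ) = ⟪e, y⟫ + t := by
      rw [inner_add_right, inner_smul_right, hee, mul_one]
    have h3 : (y + t • e) - (⟪e, y⟫ + t) • e = y - ⟪e, y⟫ • e := by
      rw [add_smul]; abel
    rw [h2, h3]; ring
  refine ⟨e, he, _, hF, hline, r, hr, fun y hy => ?_⟩
  have hball : Metric.ball x r ∈ 𝓝 y := Metric.isOpen_ball.mem_nhds hy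
  constructor
  · intro hyf
    rw [hopen.frontier_eq] at hyf
    refine le_antisymm ?_ ?_
    · by_contra! hpos
      exact hyf.2 ((h y hy).2 (by linarith))
    · by_contra! hneg
      have hev : ∀ᶠ z in 𝓝 y, z ∉ Ω := by
        filter_upwards [hball, hF.continuous.continuousAt.eventually (gt_mem_nhds hneg)]
          with z hz hz' hzΩ
        have := (h z hz).1 hzΩ
        linarith
      exact (mem_closure_iff_frequently.1 hyf.1) hev
  · intro hy0
    rw [hopen.frontier_eq]
    refine ⟨?_, fun hyΩ => by have := (h y hy).1 hyΩ; linarith⟩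
    have htend : Tendsto (fun t : ℝ => y + t • e) (𝓝[>] 0) (𝓝 y) := by
      have : Continuous fun t : ℝ => y + t • e := by fun_prop
      have h4 := this.tendsto 0
      rw [zero_smul, add_zero] at h4
      exact h4.mono_left nhdsWithin_le_nhds
    refine mem_closure_of_tendsto htend ?_
    filter_upwards [htend hball, self_mem_nhdsWithin] with t ht ht0
    refine (h _ ht).2 ?_
    have h5 := hline y t
    have h6 : (0 : ℝ) < t := ht0
    linarith

/-- The surface measure is finite: the frontier is compact and locally a Lipschitz image of a
bounded subset of a `(d - 1)`-dimensional Euclidean space. -/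
theorem isFiniteMeasure_surfaceMeasure {d : ℕ} {Ω : Set (Euc d)}
    (hΩ : HasSmoothBoundary Ω) (hopen : IsOpen Ω) (hbdd : Bornology.IsBounded Ω) :
    IsFiniteMeasure (surfaceMeasure Ω) := by
  have hcpt : IsCompact (frontier Ω) :=
    Metric.isCompact_of_isClosed_isBounded isClosed_frontier
      (hbdd.closure.subset frontier_subset_closure)
  refine ⟨?_⟩
  rw [Measure.restrict_apply_univ, Measure.euclideanHausdorffMeasure_def]
  have key : (Measure.hausdorffMeasure ((d - 1 : ℕ) : ℝ) : Measure (Euc d)) (frontier Ω) < ⊤ := by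
    refine hcpt.measure_lt_top_of_nhdsWithin fun x hx => ?_
    obtain ⟨e, he, F, hF, hline, r, hr, h⟩ := hΩ.exists_defining_function hopen hx
    have he0 : e ≠ 0 := by rintro rfl; simp at he
    let W : Submodule ℝ (Euc d) := (Submodule.span ℝ {e})ᗮ
    have hfin : Module.finrank ℝ W = d - 1 := by
      have h1 := Submodule.finrank_add_finrank_orthogonal (Submodule.span ℝ {e})
      rw [finrank_span_singleton he0, finrank_euclideanSpace_fin] at h1
      change Module.finrank ℝ ((Submodule.span ℝ {e})ᗮ : Submodule ℝ (Euc d)) = _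
      omega
    -- the graph parametrization of the zero set of `F` over the hyperplane orthogonal to `e`
    let p : W → Euc d := fun w => (w : Euc d) - F w • e
    have hp : ContDiff ℝ 1 p := by
      have h1 : ContDiff ℝ 1 fun w : W => (w : Euc d) := W.subtypeL.contDiff
      exact h1.sub (((hF.of_le (by simp)).comp h1).smul contDiff_const)
    let w₀ : W := W.orthogonalProjectionOnto x
    obtain ⟨K, U, hU, hK⟩ := hp.contDiffAt (x := w₀) |>.exists_lipschitzOnWith
    let U' : Set W := U ∩ Metric.closedBall w₀ 1
    have hU' : U' ∈ 𝓝 w₀ := inter_mem hU (Metric.closedBall_mem_nhds _ one_pos)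
    refine ⟨p '' U', ?_, ?_⟩
    · have hproj : Tendsto (fun y => W.orthogonalProjectionOnto y) (𝓝 x) (𝓝 w₀) :=
        W.orthogonalProjectionOnto.continuous.tendsto x
      filter_upwards [self_mem_nhdsWithin, mem_nhdsWithin_of_mem_nhds (hproj hU'),
        mem_nhdsWithin_of_mem_nhds (Metric.ball_mem_nhds x hr)] with y hyf hyU hyb
      refine ⟨W.orthogonalProjectionOnto y, hyU, ?_⟩
      have hsplit : (W.orthogonalProjectionOnto y : Euc d) = y + (-⟪e, y⟫) • e := by
        change W.starProjection y = _
        rw [Submodule.starProjection_orthogonal_val, Submodule.starProjection_unit_singleton ℝ he,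
          neg_smul, sub_eq_add_neg]
      have h0 := (h y hyb).1 hyf
      change (W.orthogonalProjectionOnto y : Euc d) - F (W.orthogonalProjectionOnto y) • e = y
      rw [hsplit, hline, h0]
      simp
    · refine ((hK.mono inter_subset_left).hausdorffMeasure_image_le (by positivity)).trans_lt ?_
      refine ENNReal.mul_lt_top (ENNReal.rpow_lt_top_of_nonneg (by positivity) (by simp)) ?_
      rw [← hfin]
      exact (measure_mono inter_subset_right).trans_lt
        (isCompact_closedBall w₀ 1).measure_lt_top
  rw [Measure.smul_apply, ENNReal.smul_def, smul_eq_mul]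
  exact ENNReal.mul_lt_top (by simp) key

/-- The tangent cone of a regular level set of a smooth function is the kernel of the
derivative, here for a level set which is a graph in the direction `e`. -/
theorem tangentConeAt_zeroSet {E : Type*} [NormedAddCommGroup E] [NormedSpace ℝ E]
    {s : Set E} {e x : E} {F : E → ℝ} (hF : DifferentiableAt ℝ F x)
    (hline : ∀ y (t : ℝ), F (y + t • e) = F y + t) (hx : F x = 0)
    (hs : ∀ᶠ y in 𝓝 x, (y ∈ s ↔ F y = 0)) :
    tangentConeAt ℝ s x = {v | fderiv ℝ F x v = 0} := by
  have hcongr : tangentConeAt ℝ s x = tangentConeAt ℝ {y | F y = 0} x := by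
    refine tangentConeAt_congr (nhdsWithin_eq_iff_eventuallyEq.2 ?_)
    filter_upwards [hs] with y hy
    exact propext hy
  rw [hcongr]
  apply Subset.antisymm
  · intro v hv
    have h1 := hF.hasFDerivAt.hasFDerivWithinAt (s := {y | F y = 0}) |>.mapsTo_tangent_cone hv
    have h2 : F '' {y | F y = 0} ⊆ {F x} := by
      rintro _ ⟨y, hy, rfl⟩
      rw [hx]; exact hy
    have h3 := tangentConeAt_mono h2 h1
    have hacc : ¬AccPt (F x) (𝓟 {F x}) := by
      rw [AccPt, not_neBot, nhdsWithin, inf_assoc, inf_principal, compl_inter_self,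
        principal_empty, inf_bot_eq]
    exact tangentConeAt_subset_zero hacc h3
  · intro v hv
    -- `y ↦ y - F y • e` retracts the space onto the level set, with derivative the identity on
    -- the kernel of the derivative of `F`
    have hΦ : HasFDerivWithinAt (fun y => y - F y • e)
        (ContinuousLinearMap.id ℝ E - (fderiv ℝ F x).smulRight e) univ x :=
      ((hasFDerivAt_id x).sub (hF.hasFDerivAt.smul_const e)).hasFDerivWithinAt
    have hv' : v ∈ tangentConeAt ℝ univ x := by rw [tangentConeAt_univ (𝕜 := ℝ)]; trivial
    have h1 := hΦ.mapsTo_tangent_cone hv'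
    have h2 : (fun y => y - F y • e) '' univ ⊆ {y | F y = 0} := by
      rintro _ ⟨y, -, rfl⟩
      have := hline y (-F y)
      rw [neg_smul, ← sub_eq_add_neg] at this
      change F (y - F y • e) = 0
      rw [this]; ring
    have h3 := tangentConeAt_mono h2 h1
    have h4 : fderiv ℝ F x v = 0 := hv
    simpa [hx, h4] using h3

/-- Near a boundary point the tangential gradient is `∇φ` minus its component along the normal
`∇F`, where `F` is a local defining function. -/
theorem continuousOn_tangentialGradient {d : ℕ} {Ω : Set (Euc d)} (hΩ : HasSmoothBoundary Ω)
    (hopen : IsOpen Ω) {φ : Euc d → ℝ} (hφ : IsTest φ) :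
    ContinuousOn (tangentialGradient Ω φ) (frontier Ω) := by
  intro x hx
  obtain ⟨e, he, F, hF, hline, r, hr, h⟩ := hΩ.exists_defining_function hopen hx
  have hgrad : ∀ {ψ : Euc d → ℝ}, ContDiff ℝ ∞ ψ → Continuous (∇ ψ) := fun hψ =>
    (InnerProductSpace.toDual ℝ (Euc d)).symm.continuous.comp (hψ.continuous_fderiv (by simp))
  have hFd : Differentiable ℝ F := hF.differentiable (by simp)
  -- `F` has slope one in the direction `e`
  have hne : ∀ y, ∇ F y ≠ 0 := by
    intro y h0
    have h1 : HasDerivAt (fun t : ℝ => F (y + t • e)) (fderiv ℝ F y e) 0 := by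
      have h2 : HasDerivAt (fun t : ℝ => y + t • e) e 0 := by
        simpa using ((hasDerivAt_id (0 : ℝ)).smul_const e).const_add y
      have h3 : HasFDerivAt F (fderiv ℝ F y) (y + (0 : ℝ) • e) := by
        simpa using (hFd y).hasFDerivAt
      exact h3.comp_hasDerivAt (0 : ℝ) h2
    have h4 : HasDerivAt (fun t : ℝ => F (y + t • e)) 1 0 := by
      simp only [hline]
      exact (hasDerivAt_id (0 : ℝ)).const_add _
    have h5 := h1.unique h4
    have h6 : fderiv ℝ F y = 0 := by simpa [gradient] using h0
    rw [h6] at h5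
    simp at h5
  have hformula : ∀ y ∈ frontier Ω ∩ Metric.ball x r, tangentialGradient Ω φ y
      = ∇ φ y - (⟪∇ F y, ∇ φ y⟫ / ‖∇ F y‖ ^ 2) • ∇ F y := by
    rintro y ⟨hyf, hyb⟩
    have hcone := tangentConeAt_zeroSet (s := frontier Ω) (hFd y) hline ((h y hyb).1 hyf)
      (by filter_upwards [Metric.isOpen_ball.mem_nhds hyb] with z hz using h z hz)
    have hset : {v | fderiv ℝ F y v = 0}
        = ((Submodule.span ℝ {∇ F y})ᗮ : Submodule ℝ (Euc d)) := by
      ext v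
      simp only [mem_ofPred_eq, SetLike.mem_coe, Submodule.mem_orthogonal_singleton_iff_inner_right]
      rw [gradient, InnerProductSpace.toDual_symm_apply]
    unfold tangentialGradient
    have hsp : Submodule.span ℝ (tangentConeAt ℝ (frontier Ω) y)
        = (Submodule.span ℝ {∇ F y})ᗮ := by
      rw [hcone, hset, Submodule.span_eq]
    simp only [hsp]
    rw [Submodule.starProjection_orthogonal_val, Submodule.starProjection_singleton]
    simp
  have hcont : ContinuousAt
      (fun y => ∇ φ y - (⟪∇ F y, ∇ φ y⟫ / ‖∇ F y‖ ^ 2) • ∇ F y) x := by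
    have c1 := (hgrad hφ.1).continuousAt (x := x)
    have c2 := (hgrad hF).continuousAt (x := x)
    exact c1.sub (((c2.inner c1).div (c2.norm.pow 2) (by simpa using hne x)).smul c2)
  refine hcont.continuousWithinAt.congr_of_eventuallyEq ?_
    (hformula x ⟨hx, Metric.mem_ball_self hr⟩)
  filter_upwards [self_mem_nhdsWithin,
    mem_nhdsWithin_of_mem_nhds (Metric.ball_mem_nhds x hr)] with y hy hy'
  exact hformula y ⟨hy, hy'⟩

theorem memLp_tangentialGradient {d : ℕ} {Ω : Set (Euc d)} (hΩ : HasSmoothBoundary Ω)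
    (hopen : IsOpen Ω) (hbdd : Bornology.IsBounded Ω) {φ : Euc d → ℝ} (hφ : IsTest φ) :
    MemLp (tangentialGradient Ω φ) 2 (surfaceMeasure Ω) := by
  have := isFiniteMeasure_surfaceMeasure hΩ hopen hbdd
  have hc : Continuous (∇ φ) :=
    (InnerProductSpace.toDual ℝ (Euc d)).symm.continuous.comp (hφ.1.continuous_fderiv (by simp))
  refine (hφ.gradient_memLp (surfaceMeasure Ω)).mono
    ((continuousOn_tangentialGradient hΩ hopen hφ).aestronglyMeasurable
      isClosed_frontier.measurableSet) (Eventually.of_forall fun x => ?_)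
  exact Submodule.norm_starProjection_apply_le _ _

/-! ### Test functions as elements of `V` and `V_Γ` -/

theorem IsTest.isWeakGradient {d : ℕ} {Ω : Set (Euc d)} {φ : Euc d → ℝ} (hφ : IsTest φ) :
    IsWeakGradient Ω ((hφ.memLp (bulkMeasure Ω)).toLp φ)
      ((hφ.gradient_memLp (bulkMeasure Ω)).toLp (∇ φ)) := by
  intro ψ hψ hs
  have e1 : ∫ x in Ω, ((hφ.memLp (bulkMeasure Ω)).toLp φ) x • ∇ ψ x = ∫ x in Ω, φ x • ∇ ψ x := by
    refine integral_congr_ae ?_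
    filter_upwards [(hφ.memLp (bulkMeasure Ω)).coeFn_toLp] with x hx
    rw [hx]
  have e2 : ∫ x in Ω, ψ x • ((hφ.gradient_memLp (bulkMeasure Ω)).toLp (∇ φ)) x
      = ∫ x in Ω, ψ x • ∇ φ x := by
    refine integral_congr_ae ?_
    filter_upwards [(hφ.gradient_memLp (bulkMeasure Ω)).coeFn_toLp] with x hx
    rw [hx]
  have z1 : ∀ x, x ∉ tsupport ψ → ψ x = 0 := fun x hx => image_eq_zero_of_notMem_tsupport hx
  have z2 : ∀ x, x ∉ tsupport ψ → ∇ ψ x = 0 := fun x hx => by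
    have : fderiv ℝ ψ x = 0 :=
      image_eq_zero_of_notMem_tsupport fun h => hx (tsupport_fderiv_subset ℝ h)
    simp [gradient, this]
  have i1 : Integrable (fun x => φ x • ∇ ψ x) (volume : Measure (Euc d)) :=
    memLp_one_iff_integrable.1 ((hψ.gradient_memLp _).smul (hφ.memLp _))
  have i2 : Integrable (fun x => ψ x • ∇ φ x) (volume : Measure (Euc d)) :=
    memLp_one_iff_integrable.1 ((hφ.gradient_memLp _).smul (hψ.memLp _))
  have i3 : Integrable (fun x => φ x * ψ x) (volume : Measure (Euc d)) :=
    memLp_one_iff_integrable.1 ((hψ.memLp _).smul (hφ.memLp _))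
  rw [e1, e2, setIntegral_eq_integral_of_forall_compl_eq_zero
      (fun x hx => by rw [z2 x fun h => hx (hs h), smul_zero]),
    setIntegral_eq_integral_of_forall_compl_eq_zero
      (fun x hx => by rw [z1 x fun h => hx (hs h), zero_smul])]
  have hin : ∀ (χ : Euc d → ℝ) (v x : Euc d), ⟪v, ∇ χ x⟫ = fderiv ℝ χ x v := by
    intro χ v x
    rw [real_inner_comm, gradient, InnerProductSpace.toDual_symm_apply]
  refine ext_inner_left ℝ fun v => ?_
  rw [inner_neg_right, ← integral_inner i1, ← integral_inner i2]
  simp only [inner_smul_right, hin]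
  have k1 : Integrable (fun x => φ x * fderiv ℝ ψ x v) (volume : Measure (Euc d)) := by
    simpa only [inner_smul_right, hin] using i1.const_inner (𝕜 := ℝ) v
  have k2 : Integrable (fun x => ψ x * fderiv ℝ φ x v) (volume : Measure (Euc d)) := by
    simpa only [inner_smul_right, hin] using i2.const_inner (𝕜 := ℝ) v
  rw [integral_mul_fderiv_eq_neg_fderiv_mul_of_integrable (by simpa only [mul_comm] using k2) k1 i3
    (fun x _ => hφ.1.differentiable (by simp) x) (fun x _ => hψ.1.differentiable (by simp) x)]
  simp only [mul_comm]

/-- A test function defines elements of `V` and `V_Γ`, the second one being the trace of the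
first one. -/
theorem IsTest.exists_isTrace {d : ℕ} {Ω : Set (Euc d)} (hΩ : HasSmoothBoundary Ω)
    (hopen : IsOpen Ω) (hbdd : Bornology.IsBounded Ω) {φ : Euc d → ℝ} (hφ : IsTest φ) :
    ∃ (z : VBulk Ω) (zΓ : VBdry Ω), IsTrace z (VBdry.val zΓ) ∧
      VBulk.val z =ᵐ[bulkMeasure Ω] φ ∧ VBdry.val zΓ =ᵐ[surfaceMeasure Ω] φ := by
  have := isFiniteMeasure_surfaceMeasure hΩ hopen hbdd
  have hT := memLp_tangentialGradient hΩ hopen hbdd hφ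
  let z : VBulk Ω := ⟨WithLp.toLp 2 ((hφ.memLp (bulkMeasure Ω)).toLp φ,
    (hφ.gradient_memLp (bulkMeasure Ω)).toLp (∇ φ)), hφ.isWeakGradient⟩
  let zΓ : VBdry Ω := ⟨WithLp.toLp 2 ((hφ.memLp (surfaceMeasure Ω)).toLp φ, hT.toLp _),
    subset_closure ⟨φ, hφ, (hφ.memLp (surfaceMeasure Ω)).coeFn_toLp, hT.coeFn_toLp⟩⟩
  have h1 : VBulk.val z =ᵐ[bulkMeasure Ω] φ := (hφ.memLp (bulkMeasure Ω)).coeFn_toLp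
  have h2 : VBdry.val zΓ =ᵐ[surfaceMeasure Ω] φ := (hφ.memLp (surfaceMeasure Ω)).coeFn_toLp
  exact ⟨z, zΓ, subset_closure ⟨φ, hφ, h1, (hφ.gradient_memLp (bulkMeasure Ω)).coeFn_toLp, h2⟩,
    h1, h2⟩

/-! ### The reaction terms -/

theorem IsPotential.monotone_subdiff {b : ℝ → ℝ≥0∞} (hb : IsPotential b) {r₁ r₂ s₁ s₂ : ℝ}
    (h₁ : s₁ ∈ subdiff b r₁) (h₂ : s₂ ∈ subdiff b r₂) : 0 ≤ (s₁ - s₂) * (r₁ - r₂) := by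
  -- comparison with the value at `0` shows that the potential is finite where it has subgradients
  have hfin : ∀ {r s : ℝ}, s ∈ subdiff b r → ∃ c : ℝ≥0, b r = c := by
    intro r s h
    have h0 := h 0
    rw [hb.zero] at h0
    cases hbr : b r with
    | top =>
      rw [hbr, EReal.coe_ennreal_top, EReal.top_add_coe] at h0
      exact absurd h0 (by simp)
    | coe c => exact ⟨c, rfl⟩
  obtain ⟨c₁, hc₁⟩ := hfin h₁
  obtain ⟨c₂, hc₂⟩ := hfin h₂
  have k₁ := h₁ r₂
  have k₂ := h₂ r₁
  rw [hc₁, hc₂] at k₁ k₂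
  have e : ∀ c : ℝ≥0, (((c : ℝ≥0∞) : EReal)) = (((c : ℝ) : EReal)) := fun _ => rfl
  rw [e, e, ← EReal.coe_add, EReal.coe_le_coe_iff] at k₁ k₂
  nlinarith

section Reaction

variable {α : Type*} [MeasurableSpace α] {μ : Measure α} [IsFiniteMeasure μ]

theorem memLp_lipschitz_comp {π : ℝ → ℝ} {L : ℝ≥0} (hπ : LipschitzWith L π) (w : Lp ℝ 2 μ) :
    MemLp (fun x => π (w x)) 2 μ := by
  have h1 : LipschitzWith L fun r => π r - π 0 :=
    LipschitzWith.of_dist_le_mul fun r s => by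
      simpa [Real.dist_eq] using hπ.dist_le_mul r s
  have h2 := (h1.comp_memLp (by simp) (Lp.memLp w)).add (memLp_const (π 0))
  refine (memLp_congr_ae (Eventually.of_forall fun x => ?_)).1 h2
  simp

theorem integrable_reaction {π : ℝ → ℝ} {L : ℝ≥0} (hπ : LipschitzWith L π)
    (ξ w z : Lp ℝ 2 μ) : Integrable (fun x => (ξ x + π (w x)) * z x) μ :=
  ((Lp.memLp ξ).add (memLp_lipschitz_comp hπ w)).integrable_mul (Lp.memLp z)

theorem integral_reaction_sub {π : ℝ → ℝ} {L : ℝ≥0} (hπ : LipschitzWith L π)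
    (ξ₁ ξ₂ w₁ w₂ z : Lp ℝ 2 μ) :
    (∫ x, (ξ₁ x + π (w₁ x)) * z x ∂μ) - ∫ x, (ξ₂ x + π (w₂ x)) * z x ∂μ
      = ∫ x, ((ξ₁ x - ξ₂ x) + (π (w₁ x) - π (w₂ x))) * z x ∂μ := by
  rw [← integral_sub (integrable_reaction hπ _ _ _) (integrable_reaction hπ _ _ _)]
  exact integral_congr_ae (Eventually.of_forall fun x => by ring)

/-- The reaction terms are monotone up to the Lipschitz perturbation. -/
theorem neg_le_integral_reaction_sub {b : ℝ → ℝ≥0∞} (hb : IsPotential b) {π : ℝ → ℝ} {L : ℝ≥0}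
    (hπ : LipschitzWith L π) {ξ₁ ξ₂ w₁ w₂ : Lp ℝ 2 μ}
    (h₁ : ∀ᵐ x ∂μ, ξ₁ x ∈ subdiff b (w₁ x)) (h₂ : ∀ᵐ x ∂μ, ξ₂ x ∈ subdiff b (w₂ x)) :
    -(L * ‖w₁ - w₂‖ ^ 2)
      ≤ ∫ x, ((ξ₁ x - ξ₂ x) + (π (w₁ x) - π (w₂ x))) * (w₁ - w₂ : Lp ℝ 2 μ) x ∂μ := by
  have hn : ‖w₁ - w₂‖ ^ 2
      = ∫ x, (w₁ - w₂ : Lp ℝ 2 μ) x * (w₁ - w₂ : Lp ℝ 2 μ) x ∂μ := by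
    rw [← real_inner_self_eq_norm_sq, L2.inner_def]
    rfl
  rw [hn, ← neg_mul, ← integral_const_mul]
  refine integral_mono_ae
    (((Lp.memLp (w₁ - w₂)).integrable_mul (Lp.memLp (w₁ - w₂))).const_mul _)
    ((((Lp.memLp ξ₁).sub (Lp.memLp ξ₂)).add
      ((memLp_lipschitz_comp hπ w₁).sub (memLp_lipschitz_comp hπ w₂))).integrable_mul
        (Lp.memLp (w₁ - w₂))) ?_
  filter_upwards [h₁, h₂, Lp.coeFn_sub w₁ w₂] with x k₁ k₂ hx
  rw [hx, Pi.sub_apply]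
  have hm := hb.monotone_subdiff k₁ k₂
  have hL : |π (w₁ x) - π (w₂ x)| ≤ L * |w₁ x - w₂ x| := by
    simpa [Real.dist_eq] using hπ.dist_le_mul (w₁ x) (w₂ x)
  have h3 : |(π (w₁ x) - π (w₂ x)) * (w₁ x - w₂ x)| ≤ L * |w₁ x - w₂ x| * |w₁ x - w₂ x| := by
    rw [abs_mul]
    exact mul_le_mul_of_nonneg_right hL (abs_nonneg _)
  rw [mul_assoc, abs_mul_abs_self] at h3
  have h4 := neg_le_of_abs_le h3
  linarith

end Reaction

/-! ### The difference of two solutions -/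

theorem IsTrace.sub {d : ℕ} {Ω : Set (Euc d)} {w₁ w₂ : VBulk Ω} {g₁ g₂ : HBdry Ω}
    (h₁ : IsTrace w₁ g₁) (h₂ : IsTrace w₂ g₂) : IsTrace (w₁ - w₂) (g₁ - g₂) := by
  refine map_mem_closure₂ (f := fun p q : VBulk Ω × HBdry Ω => p - q) continuous_sub h₁ h₂ ?_
  rintro p ⟨φ, hφ, a1, a2, a3⟩ q ⟨ψ, hψ, b1, b2, b3⟩
  refine ⟨fun x => φ x + -1 * ψ x, hφ.add (hψ.const_mul _), ?_, ?_, ?_⟩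
  · rw [Prod.fst_sub, map_sub]
    filter_upwards [Lp.coeFn_sub (VBulk.val p.1) (VBulk.val q.1), a1, b1] with x hx ha hb
    rw [hx, Pi.sub_apply, ha, hb]
    ring
  · rw [Prod.fst_sub, map_sub]
    filter_upwards [Lp.coeFn_sub (VBulk.grad p.1) (VBulk.grad q.1), a2, b2] with x hx ha hb
    rw [hx, Pi.sub_apply, ha, hb, hφ.gradient_add (hψ.const_mul _), hψ.gradient_const_mul,
      neg_one_smul, sub_eq_add_neg]
  · rw [Prod.snd_sub]
    filter_upwards [Lp.coeFn_sub p.2 q.2, a3, b3] with x hx ha hb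
    rw [hx, Pi.sub_apply, ha, hb]
    ring

theorem VBulk.ext_val_grad {d : ℕ} {Ω : Set (Euc d)} {w₁ w₂ : VBulk Ω}
    (h : VBulk.val w₁ = VBulk.val w₂) (h' : VBulk.grad w₁ = VBulk.grad w₂) : w₁ = w₂ :=
  Subtype.ext (WithLp.ofLp_injective 2 (Prod.ext h h'))

theorem VBdry.ext_val_grad {d : ℕ} {Ω : Set (Euc d)} {w₁ w₂ : VBdry Ω}
    (h : VBdry.val w₁ = VBdry.val w₂) (h' : VBdry.grad w₁ = VBdry.grad w₂) : w₁ = w₂ :=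
  Subtype.ext (WithLp.ofLp_injective 2 (Prod.ext h h'))

theorem IsWeakTimeDeriv.sub {Y : Type} [NormedAddCommGroup Y] [NormedSpace ℝ Y] {T : ℝ}
    {y₁ y₂ y₁' y₂' : ℝ → Y} (h₁ : IsWeakTimeDeriv T y₁ y₁') (h₂ : IsWeakTimeDeriv T y₂ y₂')
    (i₁ : MemLp y₁ 2 (timeMeasure T)) (i₂ : MemLp y₂ 2 (timeMeasure T))
    (i₁' : MemLp y₁' 2 (timeMeasure T)) (i₂' : MemLp y₂' 2 (timeMeasure T)) :
    IsWeakTimeDeriv T (fun t => y₁ t - y₂ t) (fun t => y₁' t - y₂' t) := by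
  intro φ hφ hc hs
  have m1 : MemLp φ 2 (timeMeasure T) := hφ.continuous.memLp_of_hasCompactSupport hc
  have m2 : MemLp (deriv φ) 2 (timeMeasure T) :=
    (hφ.continuous_deriv (by simp)).memLp_of_hasCompactSupport hc.deriv
  have hi : ∀ {a : ℝ → ℝ} {y : ℝ → Y}, MemLp a 2 (timeMeasure T) → MemLp y 2 (timeMeasure T) →
      Integrable (fun t => a t • y t) (timeMeasure T) := fun ha hy =>
    memLp_one_iff_integrable.1 (hy.smul ha)
  simp only [smul_sub]
  rw [integral_sub (hi m2 i₁) (hi m2 i₂), integral_sub (hi m1 i₁') (hi m1 i₂'), h₁ φ hφ hc hs,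
    h₂ φ hφ hc hs]
  abel

theorem integrable_clm_apply {X : Type*} [NormedAddCommGroup X] [NormedSpace ℝ X] {μ : Measure ℝ}
    {y' : ℝ → StrongDual ℝ X} {y : ℝ → X} (hy' : MemLp y' 2 μ) (hy : MemLp y 2 μ) :
    Integrable (fun t => y' t (y t)) μ :=
  Integrable.mono' (hy'.norm.integrable_mul hy.norm)
    ((ContinuousLinearMap.id ℝ (StrongDual ℝ X)).aestronglyMeasurable_comp₂ hy'.1 hy.1)
    (Eventually.of_forall fun t => (y' t).le_opNorm (y t))

/-- The variational equation at a fixed time, for the functional values `u'`, `v'` of the time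
derivatives. -/
def WeakForm {d : ℕ} (Ω : Set (Euc d)) (ν : ℝ) (π πΓ : ℝ → ℝ) (f : HBulk Ω) (fΓ : HBdry Ω)
    (u : VBulk Ω) (v : VBdry Ω) (ξ : HBulk Ω) (ξΓ : HBdry Ω)
    (u' : StrongDual ℝ (VBulk Ω)) (v' : StrongDual ℝ (VBdry Ω)) : Prop :=
  ∀ (z : VBulk Ω) (zΓ : VBdry Ω), IsTrace z (VBdry.val zΓ) →
      u' z + (∫ x, ⟪VBulk.grad u x, VBulk.grad z x⟫ ∂bulkMeasure Ω)
        + (∫ x, (ξ x + π (VBulk.val u x)) * VBulk.val z x ∂bulkMeasure Ω)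
        + v' zΓ
        + ν * (∫ x, ⟪VBdry.grad v x, VBdry.grad zΓ x⟫ ∂surfaceMeasure Ω)
        + (∫ x, (ξΓ x + πΓ (VBdry.val v x)) * VBdry.val zΓ x ∂surfaceMeasure Ω)
      = (∫ x, f x * VBulk.val z x ∂bulkMeasure Ω)
        + (∫ x, fΓ x * VBdry.val zΓ x ∂surfaceMeasure Ω)

section Difference

variable {d : ℕ} {Ω : Set (Euc d)} [IsFiniteMeasure (bulkMeasure Ω)]
  [IsFiniteMeasure (surfaceMeasure Ω)] {ν : ℝ} {π πΓ : ℝ → ℝ} {L LΓ : ℝ≥0}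
  {f : HBulk Ω} {fΓ : HBdry Ω} {u₁ u₂ : VBulk Ω} {v₁ v₂ : VBdry Ω} {ξ₁ ξ₂ : HBulk Ω}
  {ξΓ₁ ξΓ₂ : HBdry Ω} {u₁' u₂' : StrongDual ℝ (VBulk Ω)} {v₁' v₂' : StrongDual ℝ (VBdry Ω)}

theorem WeakForm.sub (hπ : LipschitzWith L π) (hπΓ : LipschitzWith LΓ πΓ)
    (h₁ : WeakForm Ω ν π πΓ f fΓ u₁ v₁ ξ₁ ξΓ₁ u₁' v₁')
    (h₂ : WeakForm Ω ν π πΓ f fΓ u₂ v₂ ξ₂ ξΓ₂ u₂' v₂')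
    {z : VBulk Ω} {zΓ : VBdry Ω} (hz : IsTrace z (VBdry.val zΓ)) :
    (u₁' - u₂') z + ⟪VBulk.grad (u₁ - u₂), VBulk.grad z⟫
      + (∫ x, ((ξ₁ x - ξ₂ x) + (π (VBulk.val u₁ x) - π (VBulk.val u₂ x))) * VBulk.val z x
          ∂bulkMeasure Ω)
      + (v₁' - v₂') zΓ + ν * ⟪VBdry.grad (v₁ - v₂), VBdry.grad zΓ⟫
      + (∫ x, ((ξΓ₁ x - ξΓ₂ x) + (πΓ (VBdry.val v₁ x) - πΓ (VBdry.val v₂ x))) * VBdry.val zΓ x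
          ∂surfaceMeasure Ω) = 0 := by
  have e₁ := h₁ z zΓ hz
  have e₂ := h₂ z zΓ hz
  rw [← L2.inner_def, ← L2.inner_def] at e₁ e₂
  have r := integral_reaction_sub hπ ξ₁ ξ₂ (VBulk.val u₁) (VBulk.val u₂) (VBulk.val z)
  have rΓ := integral_reaction_sub hπΓ ξΓ₁ ξΓ₂ (VBdry.val v₁) (VBdry.val v₂) (VBdry.val zΓ)
  have g : (⟪VBulk.grad (u₁ - u₂), VBulk.grad z⟫ : ℝ)
      = ⟪VBulk.grad u₁, VBulk.grad z⟫ - ⟪VBulk.grad u₂, VBulk.grad z⟫ := by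
    rw [map_sub, inner_sub_left]
  have gΓ : ν * ⟪VBdry.grad (v₁ - v₂), VBdry.grad zΓ⟫
      = ν * ⟪VBdry.grad v₁, VBdry.grad zΓ⟫ - ν * ⟪VBdry.grad v₂, VBdry.grad zΓ⟫ := by
    rw [map_sub, inner_sub_left, mul_sub]
  have a : (u₁' - u₂') z = u₁' z - u₂' z := sub_apply _ _ _
  have aΓ : (v₁' - v₂') zΓ = v₁' zΓ - v₂' zΓ := sub_apply _ _ _
  linarith only [e₁, e₂, r, rΓ, g, gΓ, a, aΓ]

theorem WeakForm.energy_le {b bΓ : ℝ → ℝ≥0∞} (hb : IsPotential b) (hbΓ : IsPotential bΓ)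
    (hπ : LipschitzWith L π) (hπΓ : LipschitzWith LΓ πΓ)
    (h₁ : WeakForm Ω ν π πΓ f fΓ u₁ v₁ ξ₁ ξΓ₁ u₁' v₁')
    (h₂ : WeakForm Ω ν π πΓ f fΓ u₂ v₂ ξ₂ ξΓ₂ u₂' v₂')
    (t₁ : IsTrace u₁ (VBdry.val v₁)) (t₂ : IsTrace u₂ (VBdry.val v₂))
    (s₁ : ∀ᵐ x ∂bulkMeasure Ω, ξ₁ x ∈ subdiff b (VBulk.val u₁ x))
    (s₂ : ∀ᵐ x ∂bulkMeasure Ω, ξ₂ x ∈ subdiff b (VBulk.val u₂ x))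
    (sΓ₁ : ∀ᵐ x ∂surfaceMeasure Ω, ξΓ₁ x ∈ subdiff bΓ (VBdry.val v₁ x))
    (sΓ₂ : ∀ᵐ x ∂surfaceMeasure Ω, ξΓ₂ x ∈ subdiff bΓ (VBdry.val v₂ x)) :
    (u₁' - u₂') (u₁ - u₂) + (v₁' - v₂') (v₁ - v₂)
      ≤ (L + LΓ) * (‖VBulk.val (u₁ - u₂)‖ ^ 2 + ‖VBdry.val (v₁ - v₂)‖ ^ 2)
        - (‖VBulk.grad (u₁ - u₂)‖ ^ 2 + ν * ‖VBdry.grad (v₁ - v₂)‖ ^ 2) := by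
  have htr : IsTrace (u₁ - u₂) (VBdry.val (v₁ - v₂)) := by
    rw [map_sub]
    exact t₁.sub t₂
  have e := h₁.sub hπ hπΓ h₂ htr
  have r := neg_le_integral_reaction_sub hb hπ s₁ s₂
  have rΓ := neg_le_integral_reaction_sub hbΓ hπΓ sΓ₁ sΓ₂
  rw [← map_sub] at r rΓ
  rw [real_inner_self_eq_norm_sq, real_inner_self_eq_norm_sq] at e
  have p1 : 0 ≤ (L : ℝ) * ‖VBdry.val (v₁ - v₂)‖ ^ 2 := by positivity
  have p2 : 0 ≤ (LΓ : ℝ) * ‖VBulk.val (u₁ - u₂)‖ ^ 2 := by positivity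
  linarith

/-- If all other terms agree, the variational equations determine the selections: those in the
domain by testing with functions supported in `Ω`, then those on the boundary. -/
theorem WeakForm.selection_eq (hΩ : HasSmoothBoundary Ω) (hopen : IsOpen Ω)
    (hbdd : Bornology.IsBounded Ω) (hπ : LipschitzWith L π) (hπΓ : LipschitzWith LΓ πΓ)
    (hu : u₁ = u₂) (hv : v₁ = v₂) (hu' : u₁' = u₂') (hv' : v₁' = v₂')
    (h₁ : WeakForm Ω ν π πΓ f fΓ u₁ v₁ ξ₁ ξΓ₁ u₁' v₁')
    (h₂ : WeakForm Ω ν π πΓ f fΓ u₂ v₂ ξ₂ ξΓ₂ u₂' v₂') : ξ₁ = ξ₂ ∧ ξΓ₁ = ξΓ₂ := by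
  subst hu hv hu' hv'
  have key : ∀ φ : Euc d → ℝ, IsTest φ →
      (∫ x, φ x • (ξ₁ x - ξ₂ x) ∂bulkMeasure Ω)
        + ∫ x, φ x • (ξΓ₁ x - ξΓ₂ x) ∂surfaceMeasure Ω = 0 := by
    intro φ hφ
    obtain ⟨z, zΓ, htr, hz, hzΓ⟩ := hφ.exists_isTrace hΩ hopen hbdd
    have e := h₁.sub hπ hπΓ h₂ htr
    simp only [sub_self, map_zero, inner_zero_left, zero_apply, mul_zero, add_zero, zero_add] at e
    rw [← e]
    congr 1
    · refine integral_congr_ae ?_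
      filter_upwards [hz] with x hx
      rw [hx, smul_eq_mul, mul_comm]
    · refine integral_congr_ae ?_
      filter_upwards [hzΓ] with x hx
      rw [hx, smul_eq_mul, mul_comm]
  have i1 : Integrable (fun x => ξ₁ x - ξ₂ x) (bulkMeasure Ω) :=
    ((Lp.memLp ξ₁).sub (Lp.memLp ξ₂)).integrable one_le_two
  have i2 : Integrable (fun x => ξΓ₁ x - ξΓ₂ x) (surfaceMeasure Ω) :=
    ((Lp.memLp ξΓ₁).sub (Lp.memLp ξΓ₂)).integrable one_le_two
  have bulk : ∀ᵐ x ∂bulkMeasure Ω, ξ₁ x - ξ₂ x = 0 := by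
    rw [ae_restrict_iff' hopen.measurableSet]
    refine hopen.ae_eq_zero_of_integral_contDiff_smul_eq_zero
      (IntegrableOn.locallyIntegrableOn i1) fun φ hφ hc hs => ?_
    have k := key φ ⟨hφ, hc⟩
    have hΓ : ∫ x, φ x • (ξΓ₁ x - ξΓ₂ x) ∂surfaceMeasure Ω = 0 := by
      refine setIntegral_eq_zero_of_forall_eq_zero fun x hx => ?_
      rw [hopen.frontier_eq] at hx
      rw [image_eq_zero_of_notMem_tsupport fun h => hx.2 (hs h), zero_smul]
    rw [hΓ, add_zero] at k
    rw [← k, setIntegral_eq_integral_of_forall_compl_eq_zero]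
    intro x hx
    rw [image_eq_zero_of_notMem_tsupport fun h => hx (hs h), zero_smul]
  have bdry : ∀ᵐ x ∂surfaceMeasure Ω, ξΓ₁ x - ξΓ₂ x = 0 := by
    refine ae_eq_zero_of_integral_contDiff_smul_eq_zero i2.locallyIntegrable fun φ hφ hc => ?_
    have k := key φ ⟨hφ, hc⟩
    have hΩ0 : ∫ x, φ x • (ξ₁ x - ξ₂ x) ∂bulkMeasure Ω = 0 := by
      rw [← integral_zero (Euc d) ℝ (μ := bulkMeasure Ω)]
      refine integral_congr_ae ?_
      filter_upwards [bulk] with x hx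
      rw [hx, smul_zero]
    rwa [hΩ0, zero_add] at k
  exact ⟨Lp.ext (bulk.mono fun x hx => sub_eq_zero.1 hx),
    Lp.ext (bdry.mono fun x hx => sub_eq_zero.1 hx)⟩

end Difference

/-! ### Uniqueness from the energy inequality -/

theorem IsWeakTimeDeriv.pivot_sub {X K : Type} [NormedAddCommGroup X] [NormedSpace ℝ X]
    [NormedAddCommGroup K] [InnerProductSpace ℝ K] {ι : X →L[ℝ] K} {T : ℝ}
    {y₁ y₂ : ℝ → X} {y₁' y₂' : ℝ → StrongDual ℝ X}
    (h₁ : IsWeakTimeDeriv T (fun t => pivot ι (ι (y₁ t))) y₁')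
    (h₂ : IsWeakTimeDeriv T (fun t => pivot ι (ι (y₂ t))) y₂')
    (i₁ : MemLp y₁ 2 (timeMeasure T)) (i₂ : MemLp y₂ 2 (timeMeasure T))
    (i₁' : MemLp y₁' 2 (timeMeasure T)) (i₂' : MemLp y₂' 2 (timeMeasure T)) :
    IsWeakTimeDeriv T (fun t => pivot ι (ι (y₁ t - y₂ t))) (fun t => y₁' t - y₂' t) := by
  simp only [map_sub]
  exact h₁.sub h₂ ((pivot ι).comp_memLp' (ι.comp_memLp' i₁))
    ((pivot ι).comp_memLp' (ι.comp_memLp' i₂)) i₁' i₂'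

theorem IsWeakTimeDeriv.pivot_congr {X K : Type} [NormedAddCommGroup X] [NormedSpace ℝ X]
    [NormedAddCommGroup K] [InnerProductSpace ℝ K] {ι : X →L[ℝ] K} {T : ℝ}
    {y₁ y₂ : ℝ → X} {y₁' y₂' : ℝ → StrongDual ℝ X}
    (h₁ : IsWeakTimeDeriv T (fun t => pivot ι (ι (y₁ t))) y₁')
    (h₂ : IsWeakTimeDeriv T (fun t => pivot ι (ι (y₂ t))) y₂')
    (i₁ : MemLp y₁ 2 (timeMeasure T)) (i₂ : MemLp y₂ 2 (timeMeasure T))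
    (i₁' : MemLp y₁' 2 (timeMeasure T)) (i₂' : MemLp y₂' 2 (timeMeasure T))
    (h : ∀ᵐ t ∂timeMeasure T, y₁ t = y₂ t) : ∀ᵐ t ∂timeMeasure T, y₁' t = y₂' t := by
  have h0 := (h₁.pivot_sub h₂ i₁ i₂ i₁' i₂').ae_eq_zero
    (by filter_upwards [h] with t ht; rw [ht, sub_self, map_zero, map_zero]) (i₁'.sub i₂')
  exact h0.mono fun t ht => sub_eq_zero.1 ht

theorem HasInitialValue.map_sub {X K : Type} [NormedAddCommGroup X] [NormedSpace ℝ X]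
    [NormedAddCommGroup K] [NormedSpace ℝ K] {ι : X →L[ℝ] K} {T : ℝ} {y₁ y₂ : ℝ → X} {k : K}
    (h₁ : HasInitialValue T (fun t => ι (y₁ t)) k) (h₂ : HasInitialValue T (fun t => ι (y₂ t)) k) :
    HasInitialValue T (fun t => ι (y₁ t - y₂ t)) 0 := by
  obtain ⟨Y₁, hY₁, hYy₁, hY₁0⟩ := h₁
  obtain ⟨Y₂, hY₂, hYy₂, hY₂0⟩ := h₂
  refine ⟨fun t => Y₁ t - Y₂ t, hY₁.sub hY₂, ?_, by simp [hY₁0, hY₂0]⟩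
  filter_upwards [hYy₁, hYy₂] with t k₁ k₂
  rw [k₁, k₂, _root_.map_sub]

/-- Grönwall's argument for a pair of weakly differentiable functions with zero initial values. The
dissipation `R` is kept in the integrated inequality, which forces it to vanish as well. -/
theorem ae_eq_zero_of_dissipation {X₁ K₁ X₂ K₂ : Type}
    [NormedAddCommGroup X₁] [NormedSpace ℝ X₁] [NormedAddCommGroup K₁] [InnerProductSpace ℝ K₁]
    [NormedAddCommGroup X₂] [NormedSpace ℝ X₂] [NormedAddCommGroup K₂] [InnerProductSpace ℝ K₂]
    (ι₁ : X₁ →L[ℝ] K₁) (ι₂ : X₂ →L[ℝ] K₂) {T C : ℝ} (hT : 0 < T)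
    {y₁ : ℝ → X₁} {y₁' : ℝ → StrongDual ℝ X₁} {y₂ : ℝ → X₂} {y₂' : ℝ → StrongDual ℝ X₂}
    {R : ℝ → ℝ}
    (hy₁ : MemLp y₁ 2 (timeMeasure T)) (hy₁' : MemLp y₁' 2 (timeMeasure T))
    (h₁ : IsWeakTimeDeriv T (fun t => pivot ι₁ (ι₁ (y₁ t))) y₁')
    (hi₁ : HasInitialValue T (fun t => ι₁ (y₁ t)) 0)
    (hy₂ : MemLp y₂ 2 (timeMeasure T)) (hy₂' : MemLp y₂' 2 (timeMeasure T))
    (h₂ : IsWeakTimeDeriv T (fun t => pivot ι₂ (ι₂ (y₂ t))) y₂')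
    (hi₂ : HasInitialValue T (fun t => ι₂ (y₂ t)) 0)
    (hR : Integrable R (timeMeasure T)) (hR0 : ∀ t, 0 ≤ R t)
    (hle : ∀ᵐ t ∂timeMeasure T, y₁' t (y₁ t) + y₂' t (y₂ t)
      ≤ C * (‖ι₁ (y₁ t)‖ ^ 2 + ‖ι₂ (y₂ t)‖ ^ 2) - R t) :
    ∀ᵐ t ∂timeMeasure T, ι₁ (y₁ t) = 0 ∧ ι₂ (y₂ t) = 0 ∧ R t = 0 := by
  obtain ⟨Y₁, hY₁, hYy₁, hY₁0⟩ := hi₁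
  obtain ⟨Y₂, hY₂, hYy₂, hY₂0⟩ := hi₂
  let E : ℝ → ℝ := fun t => ‖Y₁ t‖ ^ 2 + ‖Y₂ t‖ ^ 2
  have hE : ContinuousOn E (Icc 0 T) := (hY₁.norm.pow 2).add (hY₂.norm.pow 2)
  have hE0 : ∀ t, 0 ≤ E t := fun t => by positivity
  have henergy : ∀ τ ∈ Icc 0 T,
      E τ ≤ 2 * C * (∫ t in (0 : ℝ)..τ, E t) - 2 * ∫ t in Ioo 0 τ, R t := by
    intro τ hτ
    have hmono : volume.restrict (Ioo 0 τ) ≤ timeMeasure T :=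
      Measure.restrict_mono (Ioo_subset_Ioo_right hτ.2) le_rfl
    have i₁ := (integrable_clm_apply hy₁' hy₁).mono_measure hmono
    have i₂ := (integrable_clm_apply hy₂' hy₂).mono_measure hmono
    have iE : Integrable E (volume.restrict (Ioo 0 τ)) :=
      hE.integrableOn_Icc.mono_set (fun t ht => ⟨ht.1.le, ht.2.le.trans hτ.2⟩)
    have e₁ := sq_norm_le_two_mul_integral ι₁ hT hy₁ hy₁' h₁ hY₁ hYy₁ hY₁0 hτ
    have e₂ := sq_norm_le_two_mul_integral ι₂ hT hy₂ hy₂' h₂ hY₂ hYy₂ hY₂0 hτ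
    have hint : ∫ t in Ioo 0 τ, (y₁' t (y₁ t) + y₂' t (y₂ t))
        ≤ ∫ t in Ioo 0 τ, (C * E t - R t) := by
      refine integral_mono_ae (i₁.add i₂) ((iE.const_mul C).sub (hR.mono_measure hmono)) ?_
      filter_upwards [hmono.absolutelyContinuous.ae_le hle,
        hmono.absolutelyContinuous.ae_le hYy₁, hmono.absolutelyContinuous.ae_le hYy₂]
        with t ht k₁ k₂
      simp only [E, k₁, k₂]
      exact ht
    rw [integral_add i₁ i₂, integral_sub (iE.const_mul C) (hR.mono_measure hmono),
      integral_const_mul] at hint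
    rw [intervalIntegral.integral_of_le hτ.1, integral_Ioc_eq_integral_Ioo]
    simp only [E] at hint ⊢
    linarith
  have hEz : ∀ t ∈ Icc 0 T, E t = 0 := fun t ht =>
    eq_zero_of_le_mul_integral (C := 2 * C) hE (fun t _ => hE0 t) (fun τ hτ => by
      have := henergy τ hτ
      have : 0 ≤ ∫ t in Ioo 0 τ, R t := integral_nonneg hR0
      linarith) ht
  have hRz : ∀ᵐ t ∂timeMeasure T, R t = 0 := by
    have h0 := henergy T (right_mem_Icc.2 hT.le)
    have hz : ∫ t in (0 : ℝ)..T, E t = 0 := by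
      rw [intervalIntegral.integral_congr (g := fun _ => 0)]
      · simp
      · intro t ht
        rw [uIcc_of_le hT.le] at ht
        exact hEz t ht
    rw [hz, mul_zero, zero_sub] at h0
    have h1 : ∫ t in Ioo 0 T, R t = 0 :=
      le_antisymm (by linarith [hE0 T]) (integral_nonneg hR0)
    exact (integral_eq_zero_iff_of_nonneg hR0 hR).1 h1
  filter_upwards [hYy₁, hYy₂, hRz, ae_restrict_mem measurableSet_Ioo] with t k₁ k₂ k₃ ht
  have hz := hEz t (Ioo_subset_Icc_self ht)
  have a := sq_nonneg ‖Y₁ t‖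
  have b := sq_nonneg ‖Y₂ t‖
  simp only [E] at hz
  refine ⟨?_, ?_, k₃⟩
  · rw [← k₁, ← norm_eq_zero]
    exact pow_eq_zero_iff two_ne_zero |>.1 (by linarith)
  · rw [← k₂, ← norm_eq_zero]
    exact pow_eq_zero_iff two_ne_zero |>.1 (by linarith)

end AllenCahn

theorem mainTheorem2 {d : ℕ} (hd : 2 ≤ d) (Ω : Set (AllenCahn.Euc d))
    (hΩ_open : IsOpen Ω) (hΩ_conn : IsConnected Ω) (hΩ_bdd : Bornology.IsBounded Ω)
    (hΩ_smooth : AllenCahn.HasSmoothBoundary Ω)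
    (T : ℝ) (hT : 0 < T) (ν : ℝ) (hν : 0 < ν)
    (b bΓ : ℝ → ℝ≥0∞) (hb : AllenCahn.IsPotential b) (hbΓ : AllenCahn.IsPotential bΓ)
    (π πΓ : ℝ → ℝ) (L LΓ : ℝ≥0) (hπ : LipschitzWith L π) (hπΓ : LipschitzWith LΓ πΓ)
    (f : AllenCahn.L2Time T (AllenCahn.HBulk Ω)) (fΓ : AllenCahn.L2Time T (AllenCahn.HBdry Ω))
    (u₀ : AllenCahn.HBulk Ω) (v₀ : AllenCahn.HBdry Ω)
    (u₁ u₂ : AllenCahn.L2Time T (AllenCahn.VBulk Ω))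
    (v₁ v₂ : AllenCahn.L2Time T (AllenCahn.VBdry Ω))
    (ξ₁ ξ₂ : AllenCahn.L2Time T (AllenCahn.HBulk Ω))
    (ξΓ₁ ξΓ₂ : AllenCahn.L2Time T (AllenCahn.HBdry Ω))
    (h₁ : AllenCahn.IsSolution Ω T ν b bΓ π πΓ f fΓ u₀ v₀ u₁ v₁ ξ₁ ξΓ₁)
    (h₂ : AllenCahn.IsSolution Ω T ν b bΓ π πΓ f fΓ u₀ v₀ u₂ v₂ ξ₂ ξΓ₂) :
    u₁ = u₂ ∧ v₁ = v₂ ∧ ξ₁ = ξ₂ ∧ ξΓ₁ = ξΓ₂ := by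
  have hfin := AllenCahn.isFiniteMeasure_surfaceMeasure hΩ_smooth hΩ_open hΩ_bdd
  have hfin' : IsFiniteMeasure (AllenCahn.bulkMeasure Ω) :=
    ⟨by rw [Measure.restrict_apply_univ]; exact hΩ_bdd.measure_lt_top⟩
  obtain ⟨tr₁, s₁, sΓ₁, iu₁, iv₁, u₁', v₁', du₁, dv₁, eq₁⟩ := h₁
  obtain ⟨tr₂, s₂, sΓ₂, iu₂, iv₂, u₂', v₂', du₂, dv₂, eq₂⟩ := h₂
  have mu : MemLp (fun t => u₁ t - u₂ t) 2 (AllenCahn.timeMeasure T) :=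
    (Lp.memLp u₁).sub (Lp.memLp u₂)
  have mv : MemLp (fun t => v₁ t - v₂ t) 2 (AllenCahn.timeMeasure T) :=
    (Lp.memLp v₁).sub (Lp.memLp v₂)
  have mu' : MemLp (fun t => u₁' t - u₂' t) 2 (AllenCahn.timeMeasure T) :=
    (Lp.memLp u₁').sub (Lp.memLp u₂')
  have mv' : MemLp (fun t => v₁' t - v₂' t) 2 (AllenCahn.timeMeasure T) :=
    (Lp.memLp v₁').sub (Lp.memLp v₂')
  have du : AllenCahn.IsWeakTimeDeriv T
      (fun t => AllenCahn.pivot AllenCahn.VBulk.val (AllenCahn.VBulk.val (u₁ t - u₂ t)))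
      (fun t => u₁' t - u₂' t) :=
    du₁.pivot_sub du₂ (Lp.memLp u₁) (Lp.memLp u₂) (Lp.memLp u₁') (Lp.memLp u₂')
  have dv : AllenCahn.IsWeakTimeDeriv T
      (fun t => AllenCahn.pivot AllenCahn.VBdry.val (AllenCahn.VBdry.val (v₁ t - v₂ t)))
      (fun t => v₁' t - v₂' t) :=
    dv₁.pivot_sub dv₂ (Lp.memLp v₁) (Lp.memLp v₂) (Lp.memLp v₁') (Lp.memLp v₂')
  have hR : Integrable (fun t => ‖AllenCahn.VBulk.grad (u₁ t - u₂ t)‖ ^ 2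
      + ν * ‖AllenCahn.VBdry.grad (v₁ t - v₂ t)‖ ^ 2) (AllenCahn.timeMeasure T) :=
    ((AllenCahn.VBulk.grad.comp_memLp' mu).integrable_norm_pow two_ne_zero).add
      (((AllenCahn.VBdry.grad.comp_memLp' mv).integrable_norm_pow two_ne_zero).const_mul ν)
  have hle : ∀ᵐ t ∂AllenCahn.timeMeasure T,
      (u₁' t - u₂' t) (u₁ t - u₂ t) + (v₁' t - v₂' t) (v₁ t - v₂ t)
        ≤ (L + LΓ) * (‖AllenCahn.VBulk.val (u₁ t - u₂ t)‖ ^ 2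
            + ‖AllenCahn.VBdry.val (v₁ t - v₂ t)‖ ^ 2)
          - (‖AllenCahn.VBulk.grad (u₁ t - u₂ t)‖ ^ 2
            + ν * ‖AllenCahn.VBdry.grad (v₁ t - v₂ t)‖ ^ 2) := by
    filter_upwards [eq₁, eq₂, tr₁, tr₂, s₁, s₂, sΓ₁, sΓ₂] with t e₁ e₂ t₁ t₂ a₁ a₂ b₁ b₂
    exact AllenCahn.WeakForm.energy_le hb hbΓ hπ hπΓ e₁ e₂ t₁ t₂ a₁ a₂ b₁ b₂
  have hzero := AllenCahn.ae_eq_zero_of_dissipation AllenCahn.VBulk.val AllenCahn.VBdry.val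
    hT mu mu' du (iu₁.map_sub iu₂) mv mv' dv (iv₁.map_sub iv₂) hR (fun t => by positivity) hle
  -- elements of `V` and `V_Γ` are pairs, so the gradients have to be compared too; this is where the
  -- vanishing of the dissipation and `0 < ν` enter
  have huv : ∀ᵐ t ∂AllenCahn.timeMeasure T, u₁ t = u₂ t ∧ v₁ t = v₂ t := by
    filter_upwards [hzero] with t ht
    obtain ⟨k₁, k₂, k₃⟩ := ht
    rw [map_sub, sub_eq_zero] at k₁ k₂
    have n₁ := sq_nonneg ‖AllenCahn.VBulk.grad (u₁ t - u₂ t)‖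
    have n₂ := mul_nonneg hν.le (sq_nonneg ‖AllenCahn.VBdry.grad (v₁ t - v₂ t)‖)
    have g₁ : ‖AllenCahn.VBulk.grad (u₁ t - u₂ t)‖ ^ 2 = 0 := by linarith
    have g₂ : ν * ‖AllenCahn.VBdry.grad (v₁ t - v₂ t)‖ ^ 2 = 0 := by linarith
    rw [mul_eq_zero, or_iff_right hν.ne'] at g₂
    rw [pow_eq_zero_iff two_ne_zero, norm_eq_zero, map_sub, sub_eq_zero] at g₁ g₂
    exact ⟨AllenCahn.VBulk.ext_val_grad k₁ g₁, AllenCahn.VBdry.ext_val_grad k₂ g₂⟩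
  have zu' := du₁.pivot_congr du₂ (Lp.memLp u₁) (Lp.memLp u₂) (Lp.memLp u₁') (Lp.memLp u₂')
    (huv.mono fun t ht => ht.1)
  have zv' := dv₁.pivot_congr dv₂ (Lp.memLp v₁) (Lp.memLp v₂) (Lp.memLp v₁') (Lp.memLp v₂')
    (huv.mono fun t ht => ht.2)
  have hξ : ∀ᵐ t ∂AllenCahn.timeMeasure T, ξ₁ t = ξ₂ t ∧ ξΓ₁ t = ξΓ₂ t := by
    filter_upwards [huv, zu', zv', eq₁, eq₂] with t ht k₁ k₂ e₁ e₂
    exact AllenCahn.WeakForm.selection_eq hΩ_smooth hΩ_open hΩ_bdd hπ hπΓ ht.1 ht.2 k₁ k₂ e₁ e₂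
  exact ⟨Lp.ext (huv.mono fun t ht => ht.1), Lp.ext (huv.mono fun t ht => ht.2),
    Lp.ext (hξ.mono fun t ht => ht.1), Lp.ext (hξ.mono fun t ht => ht.2)⟩
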